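/- **Setting.** There are $m$ resources with initial inventory $b\in\mathbb R^m_{\ge 0}$ and a horizon $T$. In periods $j=1,\dots,T$ i.i.d. requests $(a_j,r_j)\in\mathbb R^m\times\mathbb R$ arrive, with law $F$. Write $F^a$ for the marginal law of $a$ and $F_a$ for the conditional cdf of $r$ given $a$ (for a fixed version of the conditional law). Suppose that $\operatorname{supp}F\subseteq[\underline A,\bar A]^m\times[0,\bar r]$ with $0<\underline A\le\bar A$, $\bar r>0$, and that, with constants $\beta\ge 0$ and $\nu,c_\nu,c_\beta>0$, one of the following two assumptions holds. * **(A1)** For every $a\in\operatorname{supp}F^a$, the conditional law of $r$ given $a$ has support $[0,r_a]$ for some $r_a>0$, and $c_\beta(z_2-z_1)^{1+\beta}\le F_a(z_2)-F_a(z_1)\le c_\nu(z_2-z_1)^\nu$ for all $0\le z_1<z_2\le r_a$. * **(A2)** $\operatorname{supp}F^a$ is convex and compact, and $F^a$ has a density that is at least $l_f>0$ on it. For every $a\in\operatorname{supp}F^a$, the conditional law of $r$ given $a$ has no point mass and has support $[l(a),r(a)]$, where $l$ and $r$ are $c_L$-Lipschitz on $\operatorname{supp}F^a$, and $c_\beta(z_2-z_1)^{1+\beta}\le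 F_a(z_2)-F_a(z_1)\le c_\nu(z_2-z_1)^\nu$ for all $l(a)\le z_1<z_2\le r(a)$. There are $a_o\in\operatorname{supp}F^a$ and $r_0>0$ such that $l(a)=0$ for all $a\in\mathcal B(a_o,r_0)\cap\operatorname{supp}F^a$. The certainty equivalent heuristic starts with $b_0=b$. In period $s<T$ it takes $$\tilde\lambda_s\in\arg\min_{\lambda\in\mathbb R^m_{\ge0}}\ \tfrac{1}{T-s}\,b_{s-1}^\top\lambda+\mathbb E_{(a,r)\sim F}\big[(r-a^\top\lambda)^+\big],$$ accepts the request if and only if $r_s\ge a_s^\top\tilde\lambda_s$ and $a_s\le b_{s-1}$ componentwise, and sets $b_s=b_{s-1}-a_s$ if it accepts and $b_s=b_{s-1}$ otherwise. For a period $1\le t<T$ let $$\lambda^\star_t\in\arg\min_{\lambda\in\mathbb R^m_{\ge0}} b_{t-1}^\top\lambda+\sum_{j=t+1}^T(r_j-a_j^\top\lambda)^+,\qquad \bar\lambda^\star_t\in\arg\min_{\lambda\in\mathbb R^m_{\ge0}} (b_{t-1}-a_t)^\top\lambda+\sum_{j=t+1}^T(r_j-a_j^\top\lambda)^+,$$ the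 latter only on the event that $a_t\le b_{t-1}$ componentwise. Any minimizers are allowed, except that in a coordinate where the capacity vector of the problem ($b_{s-1}$, $b_{t-1}$ or $b_{t-1}-a_t$) vanishes the minimizer is taken to be at most $\bar r/\underline A$ (in the other coordinates this holds almost surely for every minimizer). **Lemma.** There are a universal constant $C>0$, a constant $\tilde C_1>0$ that depends only on $m,\underline A,\bar A,\bar r,\nu,c_\nu$, and a constant $\mathcal C_4>0$ that depends under (A1) only on $m,\underline A,\bar A,\bar r,\nu,c_\nu,\beta,c_\beta$, and under (A2) only on these, $l_f$, $c_L$, $r_0$ and the set $\operatorname{supp}F^a$ (in particular none of them depends on $T$, $t$ or $b$), such that whenever $T-t\ge e^{\tilde C_1/32+1}$, $$\mathbb E_{a\sim F^a}\Big[\big(F_a(a^\top\tilde\lambda_t)-F_a(a^\top\lambda^\star_t)\big)\big(a^\top\tilde\lambda_t-a^\top\lambda^\star_t\big)\Big]\le\mathcal C_4\Big(\frac{\log(T-t)}{T-t}\Big)^{\frac{2+\beta}{2+2\beta}}$$ with probability at least $1-\dfrac{9C\log(T-t)}{(T-t)^2}$, and likewise, with probability at least $1-\dfrac{9C\log(T-t)}{(T-t)^2}$,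 either $a_t\le b_{t-1}$ fails or $$\mathbb E_{a\sim F^a}\Big[\big(F_a(a^\top\tilde\lambda_t)-F_a(a^\top\bar\lambda^\star_t)\big)\big(a^\top\tilde\lambda_t-a^\top\bar\lambda^\star_t\big)\Big]\le\mathcal C_4\Big(\frac{\log(T-t)}{T-t}\Big)^{\frac{2+\beta}{2+2\beta}}.$$ Here the expectations are over $a$ only, with the dual solutions fixed. -/

import Mathlib

open MeasureTheory ProbabilityTheory

namespace ResourceAllocation

noncomputable section

/-- `ℝ^m` with its Euclidean norm: consumption vectors, inventories and dual prices. -/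
abbrev Vec (m : ℕ) : Type := EuclideanSpace ℝ (Fin m)

/-- The inner product `aᵀ x`. -/
def dot {m : ℕ} (a x : Vec m) : ℝ := ∑ i, a i * x i

/-- Boundedness: the law `F` of a request `(a, r)` is supported in `[A, Abar]^m × [0, rbar]`. -/
structure BoundedRequests {m : ℕ} (A Abar rbar : ℝ) (F : Measure (Vec m × ℝ)) : Prop where
  lower_pos : 0 < A
  lower_le_upper : A ≤ Abar
  reward_pos : 0 < rbar
  support_subset :
    F.support ⊆ {p | (∀ i, p.1 i ∈ Set.Icc A Abar) ∧ p.2 ∈ Set.Icc 0 rbar}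

/-- The (reverse) Hölder condition for the cdf of `ρ` on the interval `[l, u]`. -/
def HolderCDF (β ν cν cβ : ℝ) (ρ : Measure ℝ) (l u : ℝ) : Prop :=
  ∀ z₁ z₂ : ℝ, l ≤ z₁ → z₁ < z₂ → z₂ ≤ u →
    cβ * (z₂ - z₁) ^ (1 + β) ≤ cdf ρ z₂ - cdf ρ z₁ ∧
      cdf ρ z₂ - cdf ρ z₁ ≤ cν * (z₂ - z₁) ^ ν

/-- First set of assumptions on the law `F` of a request `(a, r)`, where `κ a` is the conditional
law of `r` given `a`: for every `a` in the support of the marginal, the conditional reward is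
supported on an interval `[0, r_a]` that starts from zero. -/
structure SupportFromZero {m : ℕ} (A Abar rbar β ν cν cβ : ℝ)
    (F : Measure (Vec m × ℝ)) (κ : Kernel (Vec m) ℝ) : Prop where
  bounded : BoundedRequests A Abar rbar F
  β_nonneg : 0 ≤ β
  ν_pos : 0 < ν
  cν_pos : 0 < cν
  cβ_pos : 0 < cβ
  reward_law : ∀ a ∈ F.fst.support, ∃ u : ℝ, 0 < u ∧ (κ a).support = Set.Icc 0 u ∧
    HolderCDF β ν cν cβ (κ a) 0 u

/-- Second set of assumptions on the law `F` of a request `(a, r)`, where `κ a` is the conditional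
law of `r` given `a`: the conditional reward is supported on `[l a, u a]`, where `l a = 0` is only
required for `a` close to some point `a₀`, and the marginal of `a` is regular. The field
`no_point_mass` says that the conditional rewards are continuously distributed: the Hölder
condition on `[l a, u a]` alone does not see a point mass at the end point `l a`. -/
structure SupportLocallyFromZero {m : ℕ} (A Abar rbar β ν cν cβ lf : ℝ) (cL : NNReal) (r₀ : ℝ)
    (F : Measure (Vec m × ℝ)) (κ : Kernel (Vec m) ℝ) : Prop where
  bounded : BoundedRequests A Abar rbar F
  β_nonneg : 0 ≤ β
  ν_pos : 0 < ν
  cν_pos : 0 < cν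
  cβ_pos : 0 < cβ
  lf_pos : 0 < lf
  r₀_pos : 0 < r₀
  convex_support : Convex ℝ F.fst.support
  compact_support : IsCompact F.fst.support
  density : ∃ p : Vec m → ENNReal, Measurable p ∧ F.fst = volume.withDensity p ∧
    ∀ a ∈ F.fst.support, ENNReal.ofReal lf ≤ p a
  no_point_mass : ∀ a ∈ F.fst.support, ∀ z : ℝ, κ a {z} = 0
  reward_law : ∃ l u : Vec m → ℝ,
    LipschitzOnWith cL l F.fst.support ∧ LipschitzOnWith cL u F.fst.support ∧
    (∀ a ∈ F.fst.support, l a ≤ u a ∧ (κ a).support = Set.Icc (l a) (u a) ∧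
      HolderCDF β ν cν cβ (κ a) (l a) (u a)) ∧
    ∃ a₀ ∈ F.fst.support, ∀ a ∈ Metric.ball a₀ r₀ ∩ F.fst.support, l a = 0

/-- The fluid dual objective `dᵀ x + E[(r - aᵀ x)⁺]`. -/
def fluidDual {m : ℕ} (F : Measure (Vec m × ℝ)) (d x : Vec m) : ℝ :=
  dot d x + ∫ p, max (p.2 - dot p.1 x) 0 ∂F

/-- The hindsight dual objective `cᵀ x + ∑_{j = t + 1}^T (r_j - a_jᵀ x)⁺` for the realized
requests `(a_j, r_j) = req j`. -/
def hindsightDual {m : ℕ} (req : ℕ → Vec m × ℝ) (t T : ℕ) (c x : Vec m) : ℝ :=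
  dot c x + ∑ j ∈ Finset.Icc (t + 1) T, max ((req j).2 - dot (req j).1 x) 0

/-- `x` is an optimal dual solution: it minimizes the dual objective `f c` with capacity vector `c`
over the nonnegative orthant. If `c i = 0`, then large values of the price `x i` cost nothing and
the set of minimizers may be unbounded; in such a coordinate the solution is taken in the box
`[0, R]` (for `R = rbar / A`), to which minimizers are confined in every coordinate with
`c i > 0`. -/
def IsDualOptimum {m : ℕ} (R : ℝ) (f : Vec m → Vec m → ℝ) (c x : Vec m) : Prop :=
  (∀ i, 0 ≤ x i) ∧ (∀ y : Vec m, (∀ i, 0 ≤ y i) → f c x ≤ f c y) ∧ ∀ i, c i = 0 → x i ≤ R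

open Classical in
/-- The inventory after `s` periods, starting from `b`, when the request `(a_s, r_s) = req s` of
period `s` is accepted if and only if `r_s ≥ a_sᵀ lam_s` and it fits into the remaining
inventory. -/
def inventory {m : ℕ} (b : Vec m) (req : ℕ → Vec m × ℝ) (lam : ℕ → Vec m) : ℕ → Vec m
  | 0 => b
  | s + 1 =>
    if dot (req (s + 1)).1 (lam (s + 1)) ≤ (req (s + 1)).2 ∧
        ∀ i, (req (s + 1)).1 i ≤ inventory b req lam s i then
      inventory b req lam s - (req (s + 1)).1
    else inventory b req lam s

/-- `lam 1, …, lam t` are the fluid dual solutions computed by the certainty equivalent heuristic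
in periods `1, …, t`: `lam s` solves the fluid dual with normalized inventory `b_{s-1} / (T - s)`,
where `b_{s-1}` is the inventory that the heuristic has left after `s - 1` periods. -/
def IsCERun {m : ℕ} (R : ℝ) (F : Measure (Vec m × ℝ)) (T t : ℕ) (b : Vec m)
    (req : ℕ → Vec m × ℝ) (lam : ℕ → Vec m) : Prop :=
  ∀ s : ℕ, 1 ≤ s → s ≤ t →
    IsDualOptimum R (fluidDual F) (((T : ℝ) - s)⁻¹ • inventory b req lam (s - 1)) (lam s)

/-- `E_a[(F_a(aᵀ x) - F_a(aᵀ y)) (aᵀ x - aᵀ y)]`, where `a` follows its marginal law under `F` and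
`F_a` is the cdf of the conditional law `κ a` of the reward. -/
def dualGap {m : ℕ} (F : Measure (Vec m × ℝ)) (κ : Kernel (Vec m) ℝ) (x y : Vec m) : ℝ :=
  ∫ a, (cdf (κ a) (dot a x) - cdf (κ a) (dot a y)) * (dot a x - dot a y) ∂F.fst

/-- The event described by `Q` has probability at least `p`; since `Q` need not be a measurable
set, this means that it contains a measurable set of probability at least `p`. -/
def ProbAtLeast {Ω : Type*} [MeasurableSpace Ω] (P : Measure Ω) (p : ℝ) (Q : Ω → Prop) : Prop :=
  ∃ G : Set Ω, MeasurableSet G ∧ p ≤ P.real G ∧ ∀ ω ∈ G, Q ω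

/-- The concentration bounds with constants `C`, `C₁`, `C₄`, for every horizon `T`, every initial
inventory `b ≥ 0`, every i.i.d. sequence of requests `req 1, …, req T` with law `F`, every period
`t`, and all dual solutions: `lamFluid` are the fluid dual solutions along the run of the certainty
equivalent heuristic, `lamStar` is the hindsight dual solution of period `t`, and `lamBar` is the
one with inventory perturbed by `a_t`, considered only where `a_t` fits into the inventory. -/
def ConcentrationBounds.{v} {m : ℕ} (C C₁ C₄ R β : ℝ) (F : Measure (Vec m × ℝ))
    (κ : Kernel (Vec m) ℝ) : Prop :=
  ∀ (Ω : Type v) [MeasurableSpace Ω] (P : Measure Ω) [IsProbabilityMeasure P]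
    (T t : ℕ) (b : Vec m) (req : ℕ → Ω → Vec m × ℝ)
    (lamFluid : ℕ → Ω → Vec m) (lamStar lamBar : Ω → Vec m),
    (∀ i, 0 ≤ b i) →
    (∀ j ∈ Finset.Icc 1 T, HasLaw (req j) F P) →
    iIndepFun (fun j : Finset.Icc 1 T => req j) P →
    1 ≤ t → Real.exp (C₁ / 32 + 1) ≤ (T : ℝ) - t →
    (∀ᵐ ω ∂P, IsCERun R F T t b (fun j => req j ω) (fun j => lamFluid j ω)) →
    (∀ᵐ ω ∂P, IsDualOptimum R (hindsightDual (fun j => req j ω) t T)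
      (inventory b (fun j => req j ω) (fun j => lamFluid j ω) (t - 1)) (lamStar ω)) →
    (∀ᵐ ω ∂P,
      (∀ i, (req t ω).1 i ≤
        inventory b (fun j => req j ω) (fun j => lamFluid j ω) (t - 1) i) →
      IsDualOptimum R (hindsightDual (fun j => req j ω) t T)
        (inventory b (fun j => req j ω) (fun j => lamFluid j ω) (t - 1) - (req t ω).1)
        (lamBar ω)) →
    ProbAtLeast P (1 - 9 * C * Real.log ((T : ℝ) - t) / ((T : ℝ) - t) ^ 2)
        (fun ω => dualGap F κ (lamFluid t ω) (lamStar ω) ≤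
          C₄ * (Real.log ((T : ℝ) - t) / ((T : ℝ) - t)) ^ ((2 + β) / (2 + 2 * β))) ∧
      ProbAtLeast P (1 - 9 * C * Real.log ((T : ℝ) - t) / ((T : ℝ) - t) ^ 2)
        (fun ω =>
          (∀ i, (req t ω).1 i ≤
            inventory b (fun j => req j ω) (fun j => lamFluid j ω) (t - 1) i) →
          dualGap F κ (lamFluid t ω) (lamBar ω) ≤
            C₄ * (Real.log ((T : ℝ) - t) / ((T : ℝ) - t)) ^ ((2 + β) / (2 + 2 * β)))

end

end ResourceAllocation

namespace ResourceAllocation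

section Basics

variable {m : ℕ}

lemma dot_add (a x y : Vec m) : dot a (x + y) = dot a x + dot a y := by
  simp [dot, mul_add, Finset.sum_add_distrib]

lemma dot_sub (a x y : Vec m) : dot a (x - y) = dot a x - dot a y := by
  simp [dot, mul_sub, Finset.sum_sub_distrib]

lemma dot_smul (a : Vec m) (s : ℝ) (x : Vec m) : dot a (s • x) = s * dot a x := by
  simp only [dot, PiLp.smul_apply, smul_eq_mul, Finset.mul_sum]
  exact Finset.sum_congr rfl fun i _ => by ring

lemma smul_dot (s : ℝ) (a x : Vec m) : dot (s • a) x = s * dot a x := by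
  simp only [dot, PiLp.smul_apply, smul_eq_mul, Finset.mul_sum]
  exact Finset.sum_congr rfl fun i _ => by ring

lemma sub_dot (a b x : Vec m) : dot (a - b) x = dot a x - dot b x := by
  simp [dot, sub_mul, Finset.sum_sub_distrib]

lemma add_dot (a b x : Vec m) : dot (a + b) x = dot a x + dot b x := by
  simp [dot, add_mul, Finset.sum_add_distrib]

lemma continuous_dot_left (x : Vec m) : Continuous fun a : Vec m => dot a x := by
  unfold dot; fun_prop

@[fun_prop]
lemma measurable_dot_left (x : Vec m) : Measurable fun a : Vec m => dot a x :=
  (continuous_dot_left x).measurable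

/-- The box `[l, u]^m`. -/
def InBox (l u : ℝ) (x : Vec m) : Prop := ∀ i, x i ∈ Set.Icc l u

lemma InBox.dot_nonneg {A Abar R : ℝ} {a x : Vec m} (hA : 0 < A) (ha : InBox A Abar a)
    (hx : InBox 0 R x) : 0 ≤ dot a x :=
  Finset.sum_nonneg fun i _ => mul_nonneg (hA.le.trans (ha i).1) (hx i).1

lemma InBox.dot_le {A Abar R : ℝ} {a x : Vec m} (hA : 0 < A) (ha : InBox A Abar a)
    (hx : InBox 0 R x) : dot a x ≤ m * Abar * R := by
  calc dot a x ≤ ∑ _i : Fin m, Abar * R := Finset.sum_le_sum fun i _ =>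
        mul_le_mul (ha i).2 (hx i).2 (hx i).1 (hA.le.trans ((ha i).1.trans (ha i).2))
    _ = m * Abar * R := by simp; ring

lemma InBox.abs_dot_sub_le {A Abar R : ℝ} {a x y : Vec m} (hA : 0 < A) (ha : InBox A Abar a)
    (hx : InBox 0 R x) (hy : InBox 0 R y) : |dot a (y - x)| ≤ m * Abar * R := by
  rw [dot_sub, abs_le]
  have h1 := ha.dot_nonneg hA hx
  have h2 := ha.dot_nonneg hA hy
  have h3 := ha.dot_le hA hx
  have h4 := ha.dot_le hA hy
  constructor <;> linarith

lemma InBox.lineMap {R s : ℝ} {x y : Vec m} (hs0 : 0 ≤ s) (hs1 : s ≤ 1)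
    (hx : InBox 0 R x) (hy : InBox 0 R y) : InBox 0 R (x + s • (y - x)) := by
  intro i
  obtain ⟨h1, h2⟩ := hx i
  obtain ⟨h3, h4⟩ := hy i
  simp only [PiLp.add_apply, PiLp.smul_apply, PiLp.sub_apply, smul_eq_mul, Set.mem_Icc]
  constructor <;> nlinarith

variable {A Abar rbar : ℝ} {F : Measure (Vec m × ℝ)}

lemma BoundedRequests.ae_mem (hF : BoundedRequests A Abar rbar F) :
    ∀ᵐ p ∂F, InBox A Abar p.1 ∧ p.2 ∈ Set.Icc 0 rbar := by
  filter_upwards [Measure.support_mem_ae (μ := F)] with p hp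
  exact hF.support_subset hp

lemma ae_fst_of_ae {q : Vec m → Prop} (hq : MeasurableSet {a | q a}) (h : ∀ᵐ p ∂F, q p.1) :
    ∀ᵐ a ∂F.fst, q a := by
  rw [Measure.fst]
  exact (ae_map_iff measurable_fst.aemeasurable hq).2 h

lemma isClosed_inBox (l u : ℝ) : IsClosed {a : Vec m | InBox l u a} := by
  simp only [InBox, Set.ofPred_forall]
  refine isClosed_iInter fun i => ?_
  exact isClosed_Icc.preimage (by fun_prop : Continuous fun a : Vec m => a i)

lemma BoundedRequests.inBox_of_mem (hF : BoundedRequests A Abar rbar F) {a : Vec m}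
    (ha : a ∈ F.fst.support) : InBox A Abar a := by
  have h : {a : Vec m | InBox A Abar a} ∈ ae F.fst :=
    ae_fst_of_ae (isClosed_inBox _ _).measurableSet (hF.ae_mem.mono fun p hp => hp.1)
  exact Measure.support_subset_of_isClosed (isClosed_inBox A Abar) h ha

lemma BoundedRequests.ae_fst (hF : BoundedRequests A Abar rbar F) :
    ∀ᵐ a ∂F.fst, a ∈ F.fst.support ∧ InBox A Abar a := by
  filter_upwards [Measure.support_mem_ae (μ := F.fst)] with a ha
  exact ⟨ha, hF.inBox_of_mem ha⟩

/-- The consumption in direction `v` of a request accepted at prices `x`. -/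
noncomputable def score (x v : Vec m) (p : Vec m × ℝ) : ℝ :=
  if dot p.1 x < p.2 then dot p.1 v else 0

/-- The indicator of the event that the reward exceeds the price at `x` by at most `η`. -/
noncomputable def band (x : Vec m) (η : ℝ) (p : Vec m × ℝ) : ℝ :=
  if dot p.1 x < p.2 ∧ p.2 ≤ dot p.1 x + η then 1 else 0

lemma measurableSet_price_lt (x : Vec m) : MeasurableSet {p : Vec m × ℝ | dot p.1 x < p.2} :=
  measurableSet_lt ((measurable_dot_left x).comp measurable_fst) measurable_snd

@[fun_prop]
lemma measurable_score (x v : Vec m) : Measurable (score x v) :=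
  Measurable.ite (measurableSet_price_lt x) ((measurable_dot_left v).comp measurable_fst)
    measurable_const

@[fun_prop]
lemma measurable_band (x : Vec m) (η : ℝ) : Measurable (band x η) := by
  refine Measurable.ite ((measurableSet_price_lt x).inter (measurableSet_le measurable_snd ?_))
    measurable_const measurable_const
  exact ((measurable_dot_left x).comp measurable_fst).add_const _

lemma abs_score_le (x v : Vec m) (p : Vec m × ℝ) : |score x v p| ≤ |dot p.1 v| := by
  unfold score; split_ifs <;> simp

lemma band_nonneg (x : Vec m) (η : ℝ) (p : Vec m × ℝ) : 0 ≤ band x η p := by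
  unfold band; split_ifs <;> simp

lemma band_le_one (x : Vec m) (η : ℝ) (p : Vec m × ℝ) : band x η p ≤ 1 := by
  unfold band; split_ifs <;> simp

lemma band_sq (x : Vec m) (η : ℝ) (p : Vec m × ℝ) : band x η p ^ 2 = band x η p := by
  unfold band; split_ifs <;> simp

variable {κ : Kernel (Vec m) ℝ} [IsMarkovKernel κ]

lemma measurable_cdf_dot (x : Vec m) : Measurable fun a => cdf (κ a) (dot a x) := by
  simp_rw [cdf_eq_real]
  have h : MeasurableSet {p : Vec m × ℝ | p.2 ≤ dot p.1 x} :=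
    measurableSet_le measurable_snd ((measurable_dot_left x).comp measurable_fst)
  exact (Kernel.measurable_kernel_prodMk_left (κ := κ) h).ennreal_toReal

variable [IsProbabilityMeasure F] [F.IsCondKernel κ]

/-- Integrals of price-accepted quantities in terms of the conditional reward distributions. -/
lemma integral_accepted (x : Vec m) {g : Vec m → ℝ} (hg : Measurable g) {M : ℝ}
    (hM : ∀ᵐ a ∂F.fst, |g a| ≤ M) :
    ∫ p, (if dot p.1 x < p.2 then g p.1 else 0) ∂F =
      ∫ a, (1 - cdf (κ a) (dot a x)) * g a ∂F.fst := by
  have hmeas : Measurable fun p : Vec m × ℝ => if dot p.1 x < p.2 then g p.1 else 0 :=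
    Measurable.ite (measurableSet_price_lt x) (hg.comp measurable_fst) measurable_const
  have hM' : ∀ᵐ p ∂F, |g p.1| ≤ M := ae_of_ae_map measurable_fst.aemeasurable hM
  have hint : Integrable (fun p : Vec m × ℝ => if dot p.1 x < p.2 then g p.1 else 0) F := by
    refine Integrable.of_bound hmeas.aestronglyMeasurable M ?_
    filter_upwards [hM'] with p hp
    split_ifs
    · exact hp
    · simpa using (abs_nonneg _).trans hp
  have hdis : F.fst ⊗ₘ κ = F := Measure.disintegrate F κ
  conv_lhs => rw [← hdis]
  rw [Measure.integral_compProd (by rwa [hdis])]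
  refine integral_congr_ae (Filter.Eventually.of_forall fun a => ?_)
  have h1 : (fun b : ℝ => if dot a x < b then g a else 0) =
      (Set.Ioi (dot a x)).indicator fun _ => g a := by
    ext b; simp [Set.indicator_apply]
  show ∫ b, (if dot a x < b then g a else 0) ∂κ a = _
  beta_reduce
  rw [h1, integral_indicator measurableSet_Ioi, setIntegral_const, cdf_eq_real, smul_eq_mul,
    ← Set.compl_Iic, probReal_compl_eq_one_sub measurableSet_Iic]

lemma integrable_of_ae_bound {G : Vec m × ℝ → ℝ} (hG : Measurable G) {M : ℝ}
    (h : ∀ᵐ p ∂F, |G p| ≤ M) : Integrable G F :=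
  Integrable.of_bound hG.aestronglyMeasurable M h

omit [IsProbabilityMeasure F] in
lemma BoundedRequests.ae_abs_dot_le (hF : BoundedRequests A Abar rbar F) {R : ℝ} {x y : Vec m}
    (hx : InBox 0 R x) (hy : InBox 0 R y) : ∀ᵐ p ∂F, |dot p.1 (y - x)| ≤ m * Abar * R :=
  hF.ae_mem.mono fun _ hp => hp.1.abs_dot_sub_le hF.lower_pos hx hy

lemma BoundedRequests.integrable_score (hF : BoundedRequests A Abar rbar F) {R : ℝ} {x y : Vec m}
    (z : Vec m) (hx : InBox 0 R x) (hy : InBox 0 R y) : Integrable (score z (y - x)) F :=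
  integrable_of_ae_bound (measurable_score _ _)
    ((hF.ae_abs_dot_le hx hy).mono fun p hp => (abs_score_le _ _ p).trans hp)

lemma BoundedRequests.integrable_score_sq (hF : BoundedRequests A Abar rbar F) {R : ℝ}
    {x y : Vec m} (z : Vec m) (hx : InBox 0 R x) (hy : InBox 0 R y) :
    Integrable (fun p => score z (y - x) p ^ 2) F := by
  refine integrable_of_ae_bound (M := (m * Abar * R) ^ 2) (by fun_prop)
    ((hF.ae_abs_dot_le hx hy).mono fun p hp => ?_)
  rw [abs_pow]
  gcongr
  exact (abs_score_le _ _ p).trans hp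

lemma integrable_band (x : Vec m) (η : ℝ) : Integrable (band x η) F :=
  integrable_of_ae_bound (M := 1) (measurable_band _ _) (Filter.Eventually.of_forall fun p => by
    rw [abs_of_nonneg (band_nonneg _ _ _)]; exact band_le_one _ _ _)

lemma BoundedRequests.integral_score (hF : BoundedRequests A Abar rbar F) {R : ℝ} {x y : Vec m}
    (z : Vec m) (hx : InBox 0 R x) (hy : InBox 0 R y) :
    ∫ p, score z (y - x) p ∂F = ∫ a, (1 - cdf (κ a) (dot a z)) * dot a (y - x) ∂F.fst :=
  integral_accepted z (measurable_dot_left _)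
    (hF.ae_fst.mono fun _ ha => ha.2.abs_dot_sub_le hF.lower_pos hx hy)

lemma BoundedRequests.integral_score_sq (hF : BoundedRequests A Abar rbar F) {R : ℝ}
    {x y : Vec m} (z : Vec m) (hx : InBox 0 R x) (hy : InBox 0 R y) :
    ∫ p, score z (y - x) p ^ 2 ∂F =
      ∫ a, (1 - cdf (κ a) (dot a z)) * dot a (y - x) ^ 2 ∂F.fst := by
  rw [← integral_accepted (F := F) (κ := κ) (g := fun a => dot a (y - x) ^ 2)
    (M := (m * Abar * R) ^ 2) z (by fun_prop)]
  · refine integral_congr_ae (Filter.Eventually.of_forall fun p => ?_)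
    simp only [score]
    split_ifs <;> simp
  · filter_upwards [hF.ae_fst] with a ha
    rw [abs_pow]
    gcongr
    exact ha.2.abs_dot_sub_le hF.lower_pos hx hy

lemma abs_one_sub_cdf_le (ρ : Measure ℝ) (z : ℝ) : |1 - cdf ρ z| ≤ 1 := by
  rw [abs_le]
  constructor <;> linarith [cdf_nonneg ρ z, cdf_le_one ρ z]

lemma abs_cdf_sub_le (ρ : Measure ℝ) (z w : ℝ) : |cdf ρ z - cdf ρ w| ≤ 1 := by
  rw [abs_le]
  constructor <;> linarith [cdf_nonneg ρ z, cdf_le_one ρ z, cdf_nonneg ρ w, cdf_le_one ρ w]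

omit [F.IsCondKernel κ] in
lemma BoundedRequests.integrable_one_sub_cdf_mul (hF : BoundedRequests A Abar rbar F) {R : ℝ}
    {x y : Vec m} (z : Vec m) (hx : InBox 0 R x) (hy : InBox 0 R y) :
    Integrable (fun a => (1 - cdf (κ a) (dot a z)) * dot a (y - x)) F.fst := by
  refine Integrable.of_bound (C := m * Abar * R)
    (((measurable_cdf_dot z).const_sub 1).mul (measurable_dot_left _)).aestronglyMeasurable ?_
  filter_upwards [hF.ae_fst] with a ha
  rw [Real.norm_eq_abs, abs_mul]
  have := abs_one_sub_cdf_le (κ a) (dot a z)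
  have h2 := ha.2.abs_dot_sub_le hF.lower_pos hx hy
  nlinarith [abs_nonneg (dot a (y - x)), abs_nonneg (1 - cdf (κ a) (dot a z))]

lemma BoundedRequests.dualGap_eq (hF : BoundedRequests A Abar rbar F) {R : ℝ} {x y : Vec m}
    (hx : InBox 0 R x) (hy : InBox 0 R y) :
    dualGap F κ y x = ∫ p, score x (y - x) p ∂F - ∫ p, score y (y - x) p ∂F := by
  rw [hF.integral_score (κ := κ) x hx hy, hF.integral_score (κ := κ) y hx hy,
    ← integral_sub (hF.integrable_one_sub_cdf_mul x hx hy)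
      (hF.integrable_one_sub_cdf_mul y hx hy)]
  refine integral_congr_ae (Filter.Eventually.of_forall fun a => ?_)
  simp only [dot_sub]
  ring

omit [IsProbabilityMeasure F] [F.IsCondKernel κ] [IsMarkovKernel κ] in
lemma dualGap_comm (x y : Vec m) : dualGap F κ x y = dualGap F κ y x :=
  integral_congr_ae (Filter.Eventually.of_forall fun a => by ring)

lemma dualGap_integrand_nonneg (ρ : Measure ℝ) (z w : ℝ) :
    0 ≤ (cdf ρ z - cdf ρ w) * (z - w) := by
  rcases le_total z w with h | h
  · exact mul_nonneg_of_nonpos_of_nonpos (by linarith [monotone_cdf ρ h]) (by linarith)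
  · exact mul_nonneg (by linarith [monotone_cdf ρ h]) (by linarith)

omit [IsProbabilityMeasure F] [F.IsCondKernel κ] [IsMarkovKernel κ] in
lemma dualGap_nonneg (x y : Vec m) : 0 ≤ dualGap F κ x y :=
  integral_nonneg fun a => dualGap_integrand_nonneg (κ a) _ _

omit [F.IsCondKernel κ] in
lemma measurable_dualGap_integrand (x y : Vec m) :
    Measurable fun a => (cdf (κ a) (dot a y) - cdf (κ a) (dot a x)) * (dot a y - dot a x) :=
  ((measurable_cdf_dot y).sub (measurable_cdf_dot x)).mul
    ((measurable_dot_left y).sub (measurable_dot_left x))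

lemma InBox.dualGap_integrand_le {R : ℝ} (ρ : Measure ℝ) {a x y : Vec m} (hA : 0 < A)
    (ha : InBox A Abar a) (hx : InBox 0 R x) (hy : InBox 0 R y) :
    |(cdf ρ (dot a y) - cdf ρ (dot a x)) * (dot a y - dot a x)| ≤ m * Abar * R := by
  rw [abs_mul, ← dot_sub]
  have := abs_cdf_sub_le ρ (dot a y) (dot a x)
  have h2 := ha.abs_dot_sub_le hA hx hy
  nlinarith [abs_nonneg (dot a (y - x)), abs_nonneg (cdf ρ (dot a y) - cdf ρ (dot a x))]

omit [F.IsCondKernel κ] in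
lemma BoundedRequests.integrable_dualGap (hF : BoundedRequests A Abar rbar F) {R : ℝ}
    {x y : Vec m} (hx : InBox 0 R x) (hy : InBox 0 R y) :
    Integrable (fun a => (cdf (κ a) (dot a y) - cdf (κ a) (dot a x)) * (dot a y - dot a x))
      F.fst :=
  Integrable.of_bound (C := m * Abar * R) (measurable_dualGap_integrand x y).aestronglyMeasurable
    (hF.ae_fst.mono fun _ ha => ha.2.dualGap_integrand_le _ hF.lower_pos hx hy)

/-- A Hölder bound on the conditional cdfs bounds the probability of a band. -/
lemma BoundedRequests.integral_band_le (hF : BoundedRequests A Abar rbar F) {R η B : ℝ}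
    {x : Vec m} (hx : InBox 0 R x) (hη : 0 ≤ η)
    (hB : ∀ a ∈ F.fst.support, ∀ z, 0 ≤ z → cdf (κ a) (z + η) - cdf (κ a) z ≤ B) :
    ∫ p, band x η p ∂F ≤ B := by
  have hdis : F.fst ⊗ₘ κ = F := Measure.disintegrate F κ
  have h0 : ∫ p, band x η p ∂F = ∫ a, (cdf (κ a) (dot a x + η) - cdf (κ a) (dot a x)) ∂F.fst := by
    conv_lhs => rw [← hdis]
    rw [Measure.integral_compProd (by rw [hdis]; exact integrable_band x η)]
    refine integral_congr_ae (Filter.Eventually.of_forall fun a => ?_)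
    have h1 : (fun b : ℝ => band x η (a, b)) =
        (Set.Ioc (dot a x) (dot a x + η)).indicator fun _ => 1 := by
      ext b; simp [band, Set.indicator_apply]
    show ∫ b, band x η (a, b) ∂κ a = _
    beta_reduce
    rw [h1, integral_indicator measurableSet_Ioc, setIntegral_const, cdf_eq_real, cdf_eq_real,
      smul_eq_mul, mul_one, ← Set.Iic_sdiff_Iic, measureReal_sdiff _ measurableSet_Iic]
    exact Set.Iic_subset_Iic.2 (by linarith)
  rw [h0]
  have hle : ∀ᵐ a ∂F.fst, cdf (κ a) (dot a x + η) - cdf (κ a) (dot a x) ≤ B := by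
    filter_upwards [hF.ae_fst] with a ha
    exact hB a ha.1 _ (ha.2.dot_nonneg hF.lower_pos hx)
  calc _ ≤ ∫ _a, B ∂F.fst := integral_mono_of_nonneg
        (Filter.Eventually.of_forall fun a =>
          sub_nonneg.2 (monotone_cdf (κ a) (by linarith : dot a x ≤ dot a x + η)))
        (integrable_const _) hle
    _ = B := by simp

end Basics

section Concentration

variable {Ω E : Type*} [MeasurableSpace Ω] [MeasurableSpace E] {P : Measure Ω}
  [IsProbabilityMeasure P] {F : Measure E} [IsProbabilityMeasure F]

lemma exp_le_one_add_add_sq {x : ℝ} (hx : |x| ≤ 1) : Real.exp x ≤ 1 + x + x ^ 2 := by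
  have h := Real.abs_exp_sub_one_sub_id_le hx
  linarith [(abs_le.1 h).2]

/-- The moment generating function of a centred bounded variable. -/
lemma integral_exp_centred_le {g : E → ℝ} (hg : Measurable g) {l : ℝ}
    (hl : ∀ᵐ p ∂F, |l * g p| ≤ 1) (hgi : Integrable g F) :
    ∫ p, Real.exp (l * (∫ q, g q ∂F - g p)) ∂F ≤ Real.exp (l ^ 2 * ∫ q, g q ^ 2 ∂F) := by
  set μ := ∫ q, g q ∂F
  have hsq : Integrable (fun p => (l * g p) ^ 2) F := by
    refine Integrable.of_bound (C := 1) (by fun_prop) (hl.mono fun p hp => ?_)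
    rw [Real.norm_eq_abs, abs_pow]
    exact pow_le_one₀ (abs_nonneg _) hp
  have hneg : Integrable (fun p => -(l * g p)) F := (hgi.const_mul l).neg
  have hlin : Integrable (fun p => 1 + -(l * g p)) F := (integrable_const _).add hneg
  have hint : Integrable (fun p => 1 + -(l * g p) + (l * g p) ^ 2) F := hlin.add hsq
  have h1 : ∫ p, Real.exp (-(l * g p)) ∂F ≤ 1 - l * μ + l ^ 2 * ∫ q, g q ^ 2 ∂F := by
    calc ∫ p, Real.exp (-(l * g p)) ∂F ≤ ∫ p, (1 + -(l * g p) + (l * g p) ^ 2) ∂F := by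
          refine integral_mono_of_nonneg (Filter.Eventually.of_forall fun p => (Real.exp_pos _).le)
            hint (hl.mono fun p hp => ?_)
          have := exp_le_one_add_add_sq (x := -(l * g p)) (by rwa [abs_neg])
          simpa using this
      _ = 1 - l * μ + l ^ 2 * ∫ q, g q ^ 2 ∂F := by
          rw [integral_add hlin hsq, integral_add (integrable_const _) hneg, integral_neg,
            integral_const_mul]
          simp_rw [mul_pow]
          rw [integral_const_mul]
          simp [μ]
          ring
  calc ∫ p, Real.exp (l * (μ - g p)) ∂F
      = Real.exp (l * μ) * ∫ p, Real.exp (-(l * g p)) ∂F := by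
        rw [← integral_const_mul]
        refine integral_congr_ae (Filter.Eventually.of_forall fun p => ?_)
        beta_reduce
        rw [← Real.exp_add]
        ring_nf
    _ ≤ Real.exp (l * μ) * Real.exp (-(l * μ) + l ^ 2 * ∫ q, g q ^ 2 ∂F) := by
        gcongr
        refine h1.trans ?_
        have := Real.add_one_le_exp (-(l * μ) + l ^ 2 * ∫ q, g q ^ 2 ∂F)
        linarith
    _ = _ := by rw [← Real.exp_add]; ring_nf

/-- Bernstein's inequality for i.i.d. bounded variables, with a free parameter `l`. -/
lemma bernstein {ι : Type*} [Fintype ι] {X : ι → Ω → E} (hX : ∀ j, HasLaw (X j) F P)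
    (hind : iIndepFun X P) {g : E → ℝ} (hg : Measurable g) {l s : ℝ} (hl0 : 0 < l)
    (hl : ∀ᵐ p ∂F, |l * g p| ≤ 1) :
    P.real {ω | Fintype.card ι * (s / l + l * ∫ q, g q ^ 2 ∂F) ≤
      ∑ j, (∫ q, g q ∂F - g (X j ω))} ≤ Real.exp (-(Fintype.card ι * s)) := by
  set μ := ∫ q, g q ∂F with hμ
  have hgi : Integrable g F := by
    refine Integrable.of_bound (C := l⁻¹) hg.aestronglyMeasurable (hl.mono fun p hp => ?_)
    rw [abs_mul, abs_of_pos hl0] at hp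
    rw [Real.norm_eq_abs, ← one_div, le_div_iff₀ hl0]
    linarith
  let Y : ι → Ω → ℝ := fun j ω => μ - g (X j ω)
  have hm : Measurable fun p : E => μ - g p := by fun_prop
  have hY : iIndepFun Y P := hind.comp (fun _ p => μ - g p) fun _ => hm
  have hYm : ∀ j, AEMeasurable (Y j) P := fun j => hm.comp_aemeasurable (hX j).aemeasurable
  have hsum : (fun ω => ∑ j, (μ - g (X j ω))) = ∑ j, Y j := by
    ext ω; simp [Y]
  have hbd : ∀ᵐ p ∂F, |l * (μ - g p)| ≤ |l * μ| + 1 := hl.mono fun p hp => by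
    rw [mul_sub]
    exact (abs_sub _ _).trans (by linarith)
  have hbdX : ∀ j, ∀ᵐ ω ∂P, |l * Y j ω| ≤ |l * μ| + 1 := fun j => by
    have := (hX j).map_eq ▸ hbd
    exact ae_of_ae_map (hX j).aemeasurable this
  have hexp : Integrable (fun ω => Real.exp (l * (∑ j, Y j) ω)) P := by
    have hsm : AEMeasurable (∑ j, Y j) P := Finset.aemeasurable_sum _ fun j _ => hYm j
    refine Integrable.of_bound (C := Real.exp (∑ _j : ι, (|l * μ| + 1)))
      (Real.measurable_exp.comp_aemeasurable (hsm.const_mul l)).aestronglyMeasurable ?_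
    filter_upwards [ae_all_iff.2 hbdX] with ω hω
    rw [Real.norm_eq_abs, abs_of_pos (Real.exp_pos _)]
    gcongr
    rw [Finset.sum_apply, Finset.mul_sum]
    exact Finset.sum_le_sum fun j _ => (le_abs_self _).trans (hω j)
  have hmgf : ∀ j, mgf (Y j) P l ≤ Real.exp (l ^ 2 * ∫ q, g q ^ 2 ∂F) := fun j => by
    have h := integral_exp_centred_le hg hl hgi
    have h2 := (hX j).integral_comp (f := fun p => Real.exp (l * (μ - g p)))
      (by fun_prop)
    rw [← h2] at h
    exact h
  have hch := measure_ge_le_exp_mul_mgf (μ := P) (X := ∑ j, Y j)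
    (Fintype.card ι * (s / l + l * ∫ q, g q ^ 2 ∂F)) hl0.le hexp
  have heq : ∀ ω, ∑ j, (μ - g (X j ω)) = (∑ j, Y j) ω := fun ω => congrFun hsum ω
  simp_rw [heq]
  refine hch.trans ?_
  rw [hY.mgf_sum₀ hYm]
  calc _ ≤ Real.exp (-l * (Fintype.card ι * (s / l + l * ∫ q, g q ^ 2 ∂F))) *
        ∏ _j : ι, Real.exp (l ^ 2 * ∫ q, g q ^ 2 ∂F) := by
        gcongr with j
        · exact fun j _ => mgf_nonneg
        · exact hmgf j
    _ = Real.exp (-(Fintype.card ι * s)) := by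
        rw [Finset.prod_const, Finset.card_univ, ← Real.exp_nat_mul, ← Real.exp_add]
        congr 1
        field_simp
        ring

/-- Simultaneous Bernstein bounds for a finite family of functions. -/
lemma exists_uniform_deviation {ι I : Type*} [Fintype ι] [Fintype I] {X : ι → Ω → E}
    (hX : ∀ j, HasLaw (X j) F P) (hind : iIndepFun X P) {g : I → E → ℝ}
    (hg : ∀ i, Measurable (g i)) {l s : ℝ} (hl0 : 0 < l)
    (hl : ∀ i, ∀ᵐ p ∂F, |l * g i p| ≤ 1) :
    ∃ G : Set Ω, MeasurableSet G ∧
      1 - Fintype.card I * Real.exp (-(Fintype.card ι * s)) ≤ P.real G ∧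
      ∀ ω ∈ G, ∀ i, ∑ j, (∫ q, g i q ∂F - g i (X j ω)) ≤
        Fintype.card ι * (s / l + l * ∫ q, g i q ^ 2 ∂F) := by
  let B : I → Set Ω := fun i => {ω | Fintype.card ι * (s / l + l * ∫ q, g i q ^ 2 ∂F) ≤
      ∑ j, (∫ q, g i q ∂F - g i (X j ω))}
  refine ⟨(toMeasurable P (⋃ i, B i))ᶜ, (measurableSet_toMeasurable _ _).compl, ?_, ?_⟩
  · rw [probReal_compl_eq_one_sub (measurableSet_toMeasurable _ _), Measure.real,
      measure_toMeasurable, ← Measure.real]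
    have h1 : P.real (⋃ i, B i) ≤ ∑ i, P.real (B i) := measureReal_iUnion_fintype_le _
    have h2 : ∑ i, P.real (B i) ≤ ∑ _i : I, Real.exp (-(Fintype.card ι * s)) :=
      Finset.sum_le_sum fun i _ => bernstein hX hind (hg i) hl0 (hl i)
    rw [Finset.sum_const, Finset.card_univ, nsmul_eq_mul] at h2
    linarith
  · intro ω hω i
    by_contra hcon
    exact hω (subset_toMeasurable _ _ (Set.mem_iUnion.2 ⟨i, (not_le.1 hcon).le⟩))

end Concentration

section Grid

variable {m : ℕ}

/-- The points of the grid of mesh `δ` in the nonnegative orthant. -/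
noncomputable def gridPoint (δ : ℝ) {N : ℕ} (k : Fin m → Fin N) : Vec m :=
  WithLp.toLp 2 fun i => δ * ((k i : ℕ) : ℝ)

lemma inBox_gridPoint {R δ : ℝ} (hR : 0 ≤ R) (hδ : 0 < δ) (k : Fin m → Fin (⌊R / δ⌋₊ + 1)) :
    InBox 0 R (gridPoint δ k) := by
  intro i
  have h1 : ((k i : ℕ) : ℝ) ≤ ⌊R / δ⌋₊ := by exact_mod_cast Nat.lt_succ_iff.1 (k i).2
  have h2 : (⌊R / δ⌋₊ : ℝ) ≤ R / δ := Nat.floor_le (by positivity)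
  have h3 := (le_div_iff₀ hδ).1 (h1.trans h2)
  refine ⟨by simp only [gridPoint]; positivity, ?_⟩
  simp only [gridPoint]
  linarith

lemma exists_gridPoint {R δ : ℝ} (hδ : 0 < δ) {x : Vec m} (hx : InBox 0 R x) :
    ∃ k : Fin m → Fin (⌊R / δ⌋₊ + 1), InBox 0 δ (x - gridPoint δ k) := by
  have hk : ∀ i, ⌊x i / δ⌋₊ < ⌊R / δ⌋₊ + 1 := fun i => by
    refine Nat.lt_succ_iff.2 (Nat.floor_le_floor ?_)
    have := (hx i).2
    gcongr
  refine ⟨fun i => ⟨⌊x i / δ⌋₊, hk i⟩, fun i => ?_⟩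
  have h1 : (⌊x i / δ⌋₊ : ℝ) ≤ x i / δ := Nat.floor_le (div_nonneg (hx i).1 hδ.le)
  have h2 : x i / δ < ⌊x i / δ⌋₊ + 1 := Nat.lt_floor_add_one _
  rw [le_div_iff₀ hδ] at h1
  rw [div_lt_iff₀ hδ] at h2
  simp only [gridPoint, PiLp.sub_apply, Set.mem_Icc]
  constructor <;> nlinarith

/-- Moving the prices to a nearby lower grid point changes the score only on a band. -/
lemma abs_score_sub_score_le {A Abar R δ η : ℝ} {x y x' y' : Vec m} {p : Vec m × ℝ} (hA : 0 < A)
    (hp : InBox A Abar p.1) (hx' : InBox 0 R x') (hy' : InBox 0 R y')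
    (hxx : InBox 0 δ (x - x')) (hyy : InBox 0 δ (y - y')) (hη : m * Abar * δ ≤ η) :
    |score x (y - x) p - score x' (y' - x') p| ≤ m * Abar * R * band x' η p + η := by
  have hM := hp.abs_dot_sub_le hA hx' hy'
  have h1 := hp.dot_nonneg hA hxx
  have h2 := (hp.dot_le hA hxx).trans hη
  have h3 := hp.dot_nonneg hA hyy
  have h4 := (hp.dot_le hA hyy).trans hη
  simp only [dot_sub] at hM h1 h2 h3 h4
  have hM0 := (abs_nonneg _).trans hM
  have hb := mul_nonneg hM0 (band_nonneg x' η p)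
  rw [abs_le] at hM ⊢
  by_cases c' : dot p.1 x' < p.2
  · by_cases c : dot p.1 x < p.2
    · simp only [score, if_pos c, if_pos c', dot_sub]
      constructor <;> linarith
    · have hband : band x' η p = 1 := if_pos ⟨c', by linarith⟩
      simp only [score, if_neg c, if_pos c', dot_sub, hband]
      constructor <;> linarith
  · have c : ¬ dot p.1 x < p.2 := by linarith
    simp only [score, if_neg c, if_neg c']
    constructor <;> linarith

end Grid

section UniformDeviation

variable {m : ℕ} {A Abar rbar R : ℝ} {F : Measure (Vec m × ℝ)} [IsProbabilityMeasure F]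

/-- The functions whose empirical means have to be controlled: scores and bands at grid points. -/
noncomputable def gridFamily (m : ℕ) (N : ℕ) (δ η : ℝ) :
    ((Fin m → Fin N) × (Fin m → Fin N)) ⊕ (Fin m → Fin N) → Vec m × ℝ → ℝ
  | .inl k => score (gridPoint δ k.1) (gridPoint δ k.2 - gridPoint δ k.1)
  | .inr k => fun p => -band (gridPoint δ k) η p

lemma measurable_gridFamily (N : ℕ) (δ η : ℝ)
    (i : ((Fin m → Fin N) × (Fin m → Fin N)) ⊕ (Fin m → Fin N)) :
    Measurable (gridFamily m N δ η i) := by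
  cases i with
  | inl k => exact measurable_score _ _
  | inr k => exact (measurable_band _ _).neg

omit [IsProbabilityMeasure F] in
lemma BoundedRequests.abs_mul_gridFamily_le (hF : BoundedRequests A Abar rbar F) (hR : 0 ≤ R)
    {δ η l : ℝ} (hδ : 0 < δ) (hl0 : 0 < l) (hl1 : l ≤ 1) (hl : l * (m * Abar * R) ≤ 1)
    (i : ((Fin m → Fin (⌊R / δ⌋₊ + 1)) × (Fin m → Fin (⌊R / δ⌋₊ + 1))) ⊕
      (Fin m → Fin (⌊R / δ⌋₊ + 1))) :
    ∀ᵐ p ∂F, |l * gridFamily m _ δ η i p| ≤ 1 := by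
  cases i with
  | inl k =>
    filter_upwards [hF.ae_abs_dot_le (inBox_gridPoint hR hδ k.1) (inBox_gridPoint hR hδ k.2)]
      with p hp
    rw [abs_mul, abs_of_pos hl0]
    refine le_trans ?_ hl
    gcongr
    exact (abs_score_le _ _ p).trans hp
  | inr k =>
    refine Filter.Eventually.of_forall fun p => ?_
    rw [abs_mul, abs_of_pos hl0, gridFamily, abs_neg, abs_of_nonneg (band_nonneg _ _ _)]
    nlinarith [band_le_one (gridPoint δ k) η p, band_nonneg (gridPoint δ k) η p]

/-- From deviation bounds at grid points to deviation bounds at all prices. -/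
lemma BoundedRequests.uniform_deviation (hF : BoundedRequests A Abar rbar F) (hR : 0 ≤ R)
    {ι : Type*} [Fintype ι] {X : ι → Vec m × ℝ} (hX : ∀ j, InBox A Abar (X j).1)
    {δ η l τ q : ℝ} (hδ : 0 < δ) (hη0 : 0 ≤ η) (hη : m * Abar * δ ≤ η) (hηq : η ≤ q)
    (hq : q ≤ 1) (hl0 : 0 < l) (hl1 : l ≤ 1)
    (hband : ∀ x : Vec m, InBox 0 R x → ∫ p, band x η p ∂F ≤ q)
    (hdev : ∀ i, ∑ j, (∫ p, gridFamily m (⌊R / δ⌋₊ + 1) δ η i p ∂F -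
        gridFamily m (⌊R / δ⌋₊ + 1) δ η i (X j)) ≤
      Fintype.card ι * (τ + l * ∫ p, gridFamily m (⌊R / δ⌋₊ + 1) δ η i p ^ 2 ∂F))
    {x y : Vec m} (hx : InBox 0 R x) (hy : InBox 0 R y) :
    Fintype.card ι * ∫ p, score x (y - x) p ∂F - ∑ j, score x (y - x) (X j) ≤
      Fintype.card ι * ((1 + m * Abar * R) * τ + 2 * l * ∫ p, score x (y - x) p ^ 2 ∂F +
        (4 * (m * Abar * R) ^ 2 + 3 * (m * Abar * R) + 6) * q) := by
  have hAbar : 0 ≤ Abar := hF.lower_pos.le.trans hF.lower_le_upper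
  set M : ℝ := m * Abar * R with hMdef
  have hM : 0 ≤ M := by positivity
  set n : ℝ := (Fintype.card ι : ℝ)
  have hn : 0 ≤ n := Nat.cast_nonneg _
  obtain ⟨k, hk⟩ := exists_gridPoint hδ hx
  obtain ⟨k', hk'⟩ := exists_gridPoint hδ hy
  set x' := gridPoint δ k with hx'def
  set y' := gridPoint δ k' with hy'def
  have hx' : InBox 0 R x' := inBox_gridPoint hR hδ k
  have hy' : InBox 0 R y' := inBox_gridPoint hR hδ k'
  have hcmp : ∀ p : Vec m × ℝ, InBox A Abar p.1 →
      |score x (y - x) p - score x' (y' - x') p| ≤ M * band x' η p + η := fun p hp =>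
    abs_score_sub_score_le hF.lower_pos hp hx' hy' hk hk' hη
  have hd1 := hdev (.inl (k, k'))
  have hd2 := hdev (.inr k)
  simp only [gridFamily, Finset.sum_sub_distrib, Finset.sum_const, Finset.card_univ,
    nsmul_eq_mul, ← hx'def, ← hy'def, integral_neg, neg_sq, band_sq, Finset.sum_neg_distrib]
    at hd1 hd2
  change n * _ - _ ≤ n * _ at hd1
  change n * _ - _ ≤ n * _ at hd2
  have hIb0 : 0 ≤ ∫ p, band x' η p ∂F := integral_nonneg fun p => band_nonneg _ _ _
  have hIb := hband x' hx'
  have hbi : Integrable (band x' η) F := integrable_band x' η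
  have hsi := hF.integrable_score x hx hy
  have hsi' := hF.integrable_score x' hx' hy'
  have hs2 := hF.integrable_score_sq x hx hy
  have hbM : Integrable (fun p => M * band x' η p + η) F :=
    (hbi.const_mul M).add (integrable_const _)
  have hI1 : ∫ p, score x (y - x) p ∂F ≤
      ∫ p, score x' (y' - x') p ∂F + (M * ∫ p, band x' η p ∂F + η) := by
    have h1 : ∫ p, (score x' (y' - x') p + (M * band x' η p + η)) ∂F =
        ∫ p, score x' (y' - x') p ∂F + (M * ∫ p, band x' η p ∂F + η) := by
      rw [integral_add hsi' hbM, integral_add (hbi.const_mul M) (integrable_const _),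
        integral_const_mul]
      simp
    rw [← h1]
    refine integral_mono_ae hsi (hsi'.add hbM) (hF.ae_mem.mono fun p hp => ?_)
    have := (abs_le.1 (hcmp p hp.1)).2
    beta_reduce
    linarith
  have hI2 : ∫ p, score x' (y' - x') p ^ 2 ∂F ≤
      2 * ∫ p, score x (y - x) p ^ 2 ∂F + (4 * M ^ 2 * ∫ p, band x' η p ∂F + 4 * η ^ 2) := by
    have hbM2 : Integrable (fun p => 4 * M ^ 2 * band x' η p + 4 * η ^ 2) F :=
      (hbi.const_mul _).add (integrable_const _)
    have h1 : ∫ p, (2 * score x (y - x) p ^ 2 + (4 * M ^ 2 * band x' η p + 4 * η ^ 2)) ∂F =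
        2 * ∫ p, score x (y - x) p ^ 2 ∂F + (4 * M ^ 2 * ∫ p, band x' η p ∂F + 4 * η ^ 2) := by
      rw [integral_add (hs2.const_mul 2) hbM2,
        integral_add (hbi.const_mul _) (integrable_const _), integral_const_mul,
        integral_const_mul]
      simp
    rw [← h1]
    refine integral_mono_ae (hF.integrable_score_sq x' hx' hy') ((hs2.const_mul 2).add hbM2)
      (hF.ae_mem.mono fun p hp => ?_)
    have h2 := hcmp p hp.1
    have h3 : (score x (y - x) p - score x' (y' - x') p) ^ 2 ≤ (M * band x' η p + η) ^ 2 :=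
      sq_le_sq.2 (h2.trans (le_abs_self _))
    have h4 := band_sq x' η p
    have h5 : (M * band x' η p + η) ^ 2 ≤ 2 * M ^ 2 * band x' η p + 2 * η ^ 2 := by
      have : (M * band x' η p + η) ^ 2 + (M * band x' η p - η) ^ 2 =
          2 * M ^ 2 * band x' η p ^ 2 + 2 * η ^ 2 := by ring
      rw [h4] at this
      nlinarith [sq_nonneg (M * band x' η p - η)]
    beta_reduce
    nlinarith [sq_nonneg (2 * score x (y - x) p - score x' (y' - x') p)]
  have hS : ∑ j, score x' (y' - x') (X j) ≤
      ∑ j, score x (y - x) (X j) + (M * ∑ j, band x' η (X j) + n * η) := by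
    have h1 : ∑ j, (score x (y - x) (X j) + (M * band x' η (X j) + η)) =
        ∑ j, score x (y - x) (X j) + (M * ∑ j, band x' η (X j) + n * η) := by
      simp only [Finset.sum_add_distrib, Finset.mul_sum, Finset.sum_const, Finset.card_univ,
        nsmul_eq_mul, n]
    rw [← h1]
    refine Finset.sum_le_sum fun j _ => ?_
    have := (abs_le.1 (hcmp (X j) (hX j))).1
    linarith
  set V := ∫ p, score x (y - x) p ^ 2 ∂F
  set V' := ∫ p, score x' (y' - x') p ^ 2 ∂F
  set b := ∫ p, band x' η p ∂F
  set Sb := ∑ j, band x' η (X j)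
  have hV' : V' ≤ 2 * V + (4 * M ^ 2 + 4) * q := by
    have : η ^ 2 ≤ q := by nlinarith
    nlinarith [mul_le_mul_of_nonneg_left hIb (sq_nonneg M)]
  have hlV : l * V' ≤ 2 * l * V + (4 * M ^ 2 + 4) * q := by
    have hq0 : 0 ≤ q := hη0.trans hηq
    have h1 := mul_le_mul_of_nonneg_left hV' hl0.le
    have h2 : 0 ≤ (4 * M ^ 2 + 4) * q := by positivity
    nlinarith
  have hlb : l * b ≤ q := (mul_le_of_le_one_left hIb0 hl1).trans hIb
  have e1 := mul_le_mul_of_nonneg_left hlV hn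
  have e2 := mul_le_mul_of_nonneg_left hI1 hn
  have e3 : M * Sb ≤ M * (n * b + n * (τ + l * b)) := by
    gcongr
    linarith
  have e4 : n * M * b ≤ n * M * q := by gcongr
  have e5 : n * M * (l * b) ≤ n * M * q := by gcongr
  have e6 : n * η ≤ n * q := by gcongr
  linarith

end UniformDeviation

section Optimality

variable {m : ℕ}

lemma dot_single (c : Vec m) (i : Fin m) : dot c (EuclideanSpace.single i (1 : ℝ)) = c i := by
  simp [dot]

/-- Minimizers of a dual objective lie in the box `[0, R]^m` if the expected surplus `Φ` vanishes
as soon as some price is at least `R`. -/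
lemma IsDualOptimum.inBox {R : ℝ} (hR : 0 ≤ R) {f : Vec m → Vec m → ℝ} {c x : Vec m}
    (hx : IsDualOptimum R f c x) (hc : ∀ i, 0 ≤ c i) {Φ : Vec m → ℝ}
    (hf : ∀ y, f c y = dot c y + Φ y) (hΦ : ∀ y, 0 ≤ Φ y)
    (hΦ0 : ∀ y : Vec m, (∀ i, 0 ≤ y i) → ∀ i, R ≤ y i → Φ y = 0) : InBox 0 R x := by
  intro i
  refine ⟨hx.1 i, ?_⟩
  rcases (hc i).eq_or_lt with h0 | hpos
  · exact hx.2.2 i h0.symm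
  by_contra! hlt
  let y : Vec m := x - (x i - R) • EuclideanSpace.single i (1 : ℝ)
  have hyi : y i = R := by simp [y]
  have hy : ∀ j, 0 ≤ y j := fun j => by
    by_cases hj : j = i
    · rw [hj, hyi]; exact hR
    · simpa [y, hj] using hx.1 j
  have h1 := hx.2.1 y hy
  rw [hf, hf, hΦ0 y hy i hyi.ge, dot_sub, dot_smul, dot_single] at h1
  have h2 := hΦ x
  nlinarith [mul_pos (sub_pos.2 hlt) hpos]

lemma surplus_eq_zero {A Abar rbar : ℝ} (hA : 0 < A) {a y : Vec m} {r : ℝ}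
    (ha : InBox A Abar a) (hr : r ∈ Set.Icc 0 rbar) (hy : ∀ i, 0 ≤ y i) (i : Fin m)
    (hyi : rbar / A ≤ y i) : max (r - dot a y) 0 = 0 := by
  have h1 : a i * y i ≤ dot a y :=
    Finset.single_le_sum (f := fun j => a j * y j)
      (fun j _ => mul_nonneg (hA.le.trans (ha j).1) (hy j)) (Finset.mem_univ i)
  have h2 : rbar ≤ A * y i := by
    rw [div_le_iff₀ hA] at hyi
    linarith
  have h3 : A * y i ≤ a i * y i := mul_le_mul_of_nonneg_right (ha i).1 (hy i)
  exact max_eq_right (by linarith [hr.2])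

lemma IsDualOptimum.inBox_of_fluid {A Abar rbar : ℝ} {F : Measure (Vec m × ℝ)}
    (hF : BoundedRequests A Abar rbar F) {d x : Vec m} (hd : ∀ i, 0 ≤ d i)
    (hx : IsDualOptimum (rbar / A) (fluidDual F) d x) : InBox 0 (rbar / A) x := by
  refine hx.inBox (div_nonneg hF.reward_pos.le hF.lower_pos.le) hd
    (Φ := fun y => ∫ p, max (p.2 - dot p.1 y) 0 ∂F) (fun y => rfl)
    (fun y => integral_nonneg fun p => le_max_right _ _) fun y hy i hyi => ?_
  refine integral_eq_zero_of_ae (hF.ae_mem.mono fun p hp => ?_)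
  exact surplus_eq_zero hF.lower_pos hp.1 hp.2 hy i hyi

lemma IsDualOptimum.inBox_of_hindsight {A Abar rbar : ℝ} (hA : 0 < A) (hr : 0 ≤ rbar)
    {req : ℕ → Vec m × ℝ} {t T : ℕ}
    (hreq : ∀ j ∈ Finset.Icc (t + 1) T, InBox A Abar (req j).1 ∧ (req j).2 ∈ Set.Icc 0 rbar)
    {c x : Vec m} (hc : ∀ i, 0 ≤ c i)
    (hx : IsDualOptimum (rbar / A) (hindsightDual req t T) c x) : InBox 0 (rbar / A) x := by
  refine hx.inBox (div_nonneg hr hA.le) hc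
    (Φ := fun y => ∑ j ∈ Finset.Icc (t + 1) T, max ((req j).2 - dot (req j).1 y) 0)
    (fun y => rfl) (fun y => Finset.sum_nonneg fun j _ => le_max_right _ _) fun y hy i hyi => ?_
  exact Finset.sum_eq_zero fun j hj => surplus_eq_zero hA (hreq j hj).1 (hreq j hj).2 hy i hyi

/-- The subgradient inequality for the surplus. -/
lemma surplus_add_score_le (w v : Vec m) (s : ℝ) (p : Vec m × ℝ) :
    max (p.2 - dot p.1 (w + s • v)) 0 + s * score (w + s • v) v p ≤
      max (p.2 - dot p.1 w) 0 := by
  simp only [score, dot_add, dot_smul]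
  split_ifs with h
  · rw [max_eq_left (by linarith)]
    refine le_max_of_le_left (by linarith)
  · rw [max_eq_right (by linarith)]
    simp

lemma score_smul (x v : Vec m) (s : ℝ) (p : Vec m × ℝ) :
    score x (s • v) p = s * score x v p := by
  simp only [score, dot_smul]
  split_ifs <;> simp

lemma score_neg (x y z : Vec m) (p : Vec m × ℝ) : score x (y - z) p = -score x (z - y) p := by
  simp only [score, dot_sub]
  split_ifs <;> simp

lemma sum_score_le_of_minimizer {ι : Type*} [Fintype ι] {X : ι → Vec m × ℝ} {c w v : Vec m}
    {s : ℝ} (hs : 0 < s)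
    (h : dot c w + ∑ j, max ((X j).2 - dot (X j).1 w) 0 ≤
      dot c (w + s • v) + ∑ j, max ((X j).2 - dot (X j).1 (w + s • v)) 0) :
    ∑ j, score (w + s • v) v (X j) ≤ dot c v := by
  have h1 := Finset.sum_le_sum fun j (_ : j ∈ Finset.univ) => surplus_add_score_le w v s (X j)
  rw [Finset.sum_add_distrib, ← Finset.mul_sum] at h1
  rw [dot_add, dot_smul] at h
  exact le_of_mul_le_mul_left (by linarith) hs

variable {A Abar rbar R : ℝ} {F : Measure (Vec m × ℝ)} [IsProbabilityMeasure F]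

lemma BoundedRequests.integrable_surplus (hF : BoundedRequests A Abar rbar F) {x : Vec m}
    (hx : InBox 0 R x) : Integrable (fun p => max (p.2 - dot p.1 x) 0) F := by
  have hm : Measurable fun p : Vec m × ℝ => max (p.2 - dot p.1 x) 0 :=
    (measurable_snd.sub ((measurable_dot_left x).comp measurable_fst)).max measurable_const
  refine integrable_of_ae_bound (M := rbar) hm (hF.ae_mem.mono fun p hp => ?_)
  rw [abs_of_nonneg (le_max_right _ _)]
  have := hp.1.dot_nonneg hF.lower_pos hx
  exact max_le (by linarith [hp.2.2]) hF.reward_pos.le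

lemma BoundedRequests.integral_score_le_of_minimizer (hF : BoundedRequests A Abar rbar F)
    {d w z : Vec m} (hw : InBox 0 R w) (hz : InBox 0 R z) {s : ℝ} (hs : 0 < s) (hs1 : s ≤ 1)
    (h : fluidDual F d w ≤ fluidDual F d (w + s • (z - w))) :
    ∫ p, score (w + s • (z - w)) (z - w) p ∂F ≤ dot d (z - w) := by
  have hy := InBox.lineMap hs.le hs1 hw hz
  have hi := hF.integrable_surplus hy
  have hsc := (hF.integrable_score (w + s • (z - w)) hw hz).const_mul s
  have h1 := integral_mono (hi.add hsc) (hF.integrable_surplus hw)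
    fun p => surplus_add_score_le w (z - w) s p
  simp only [Pi.add_apply] at h1
  rw [integral_add hi hsc, integral_const_mul] at h1
  simp only [fluidDual] at h
  rw [dot_add, dot_smul] at h
  exact le_of_mul_le_mul_left (by linarith) hs

variable {κ : Kernel (Vec m) ℝ} [IsMarkovKernel κ] [F.IsCondKernel κ]

omit [F.IsCondKernel κ] in
/-- The gap is continuous along the segment between two price vectors. -/
lemma BoundedRequests.tendsto_dualGap (hF : BoundedRequests A Abar rbar F)
    (hcont : ∀ a ∈ F.fst.support, ContinuousOn (cdf (κ a)) (Set.Ici 0))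
    {w z : Vec m} (hw : InBox 0 R w) (hz : InBox 0 R z) :
    Filter.Tendsto (fun s : ℝ => dualGap F κ (w + s • (z - w)) (z + s • (w - z)))
      (nhdsWithin 0 (Set.Ioc 0 1)) (nhds (dualGap F κ w z)) := by
  refine tendsto_integral_filter_of_dominated_convergence (fun _ => m * Abar * R)
    (Filter.Eventually.of_forall fun s =>
      (measurable_dualGap_integrand _ _).aestronglyMeasurable) ?_ (integrable_const _) ?_
  · filter_upwards [self_mem_nhdsWithin] with s hs
    filter_upwards [hF.ae_fst] with a ha
    exact ha.2.dualGap_integrand_le _ hF.lower_pos (InBox.lineMap hs.1.le hs.2 hz hw)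
      (InBox.lineMap hs.1.le hs.2 hw hz)
  · filter_upwards [hF.ae_fst] with a ha
    have key : ∀ {x y : Vec m}, InBox 0 R x → InBox 0 R y →
        Filter.Tendsto (fun s : ℝ => cdf (κ a) (dot a (x + s • (y - x))))
          (nhdsWithin 0 (Set.Ioc 0 1)) (nhds (cdf (κ a) (dot a x))) ∧
        Filter.Tendsto (fun s : ℝ => dot a (x + s • (y - x)))
          (nhdsWithin 0 (Set.Ioc 0 1)) (nhds (dot a x)) := by
      intro x y hx hy
      have h1 : Filter.Tendsto (fun s : ℝ => dot a (x + s • (y - x)))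
          (nhdsWithin 0 (Set.Ioc 0 1)) (nhds (dot a x)) := by
        have hc : Continuous fun s : ℝ => dot a (x + s • (y - x)) := by
          simp only [dot_add, dot_smul]; fun_prop
        have := hc.tendsto 0
        simp only [zero_smul, add_zero] at this
        exact this.mono_left nhdsWithin_le_nhds
      refine ⟨?_, h1⟩
      have h2 := hcont a ha.1 (dot a x) (ha.2.dot_nonneg hF.lower_pos hx)
      refine h2.tendsto.comp (tendsto_nhdsWithin_iff.2 ⟨h1, ?_⟩)
      filter_upwards [self_mem_nhdsWithin] with s hs
      exact ha.2.dot_nonneg hF.lower_pos (InBox.lineMap hs.1.le hs.2 hx hy)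
    obtain ⟨h1, h2⟩ := key hw hz
    obtain ⟨h3, h4⟩ := key hz hw
    exact (h1.sub h3).mul (h2.sub h4)

/-- Uniform deviation bounds for the scores bound the gap between fluid and hindsight optima. -/
lemma BoundedRequests.dualGap_le_of_minimizers (hF : BoundedRequests A Abar rbar F)
    (hcont : ∀ a ∈ F.fst.support, ContinuousOn (cdf (κ a)) (Set.Ici 0))
    {ι : Type*} [Fintype ι] [Nonempty ι] {X : ι → Vec m × ℝ} {c d w z : Vec m}
    (hw : InBox 0 R w) (hz : InBox 0 R z)
    (hwopt : ∀ y : Vec m, (∀ i, 0 ≤ y i) → fluidDual F d w ≤ fluidDual F d y)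
    (hzopt : ∀ y : Vec m, (∀ i, 0 ≤ y i) →
      dot c z + ∑ j, max ((X j).2 - dot (X j).1 z) 0 ≤
        dot c y + ∑ j, max ((X j).2 - dot (X j).1 y) 0)
    {e a l K θ B : ℝ} (he : 0 ≤ e)
    (hcd : dot c (w - z) - Fintype.card ι * dot d (w - z) ≤ Fintype.card ι * e)
    (hdev : ∀ x y : Vec m, InBox 0 R x → InBox 0 R y →
      Fintype.card ι * ∫ p, score x (y - x) p ∂F - ∑ j, score x (y - x) (X j) ≤
        Fintype.card ι * (a + 2 * l * ∫ p, score x (y - x) p ^ 2 ∂F))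
    (hl : 0 ≤ l)
    (hvar : ∀ x y : Vec m, InBox 0 R x → InBox 0 R y →
      ∫ p, score x (y - x) p ^ 2 ∂F ≤ K * dualGap F κ y x ^ θ)
    (hsolve : ∀ G : ℝ, 0 ≤ G → G ≤ e + a + 2 * l * (K * G ^ θ) → G ≤ B) :
    dualGap F κ w z ≤ B := by
  have hmem : ∀ᶠ s in nhdsWithin (0 : ℝ) (Set.Ioc 0 1), s ∈ Set.Ioo (0 : ℝ) (1 / 2) := by
    filter_upwards [self_mem_nhdsWithin,
      mem_nhdsWithin_of_mem_nhds (Iio_mem_nhds (by norm_num : (0 : ℝ) < 1 / 2))] with s h1 h2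
    exact ⟨h1.1, h2⟩
  have hne : (nhdsWithin (0 : ℝ) (Set.Ioc 0 1)).NeBot := by
    rw [← mem_closure_iff_nhdsWithin_neBot, closure_Ioc (by norm_num)]
    simp
  refine le_of_tendsto (hF.tendsto_dualGap hcont hw hz) (hmem.mono fun s hs => ?_)
  obtain ⟨hs0, hs2⟩ := hs
  set x := z + s • (w - z) with hxdef
  set y := w + s • (z - w) with hydef
  have hx : InBox 0 R x := InBox.lineMap hs0.le (by linarith) hz hw
  have hy : InBox 0 R y := InBox.lineMap hs0.le (by linarith) hw hz
  have hyx : y - x = (1 - 2 * s) • (w - z) := by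
    rw [hxdef, hydef]; module
  set n : ℝ := (Fintype.card ι : ℝ)
  have hn : 0 < n := Nat.cast_pos.2 Fintype.card_pos
  refine hsolve _ (dualGap_nonneg _ _) ?_
  have h1 := hF.integral_score_le_of_minimizer hw hz hs0 (by linarith)
    (hwopt y fun i => (hy i).1)
  have h2 := sum_score_le_of_minimizer hs0 (hzopt x fun i => (hx i).1)
  have h3 := hdev x y hx hy
  have h4 := hvar x y hx hy
  rw [hF.dualGap_eq hx hy]
  rw [hF.dualGap_eq hx hy] at h4
  rw [← hydef] at h1
  rw [← hxdef] at h2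
  set V := ∫ p, score x (y - x) p ^ 2 ∂F
  set G := ∫ p, score x (y - x) p ∂F - ∫ p, score y (y - x) p ∂F with hG
  have h5 : ∫ p, score y (y - x) p ∂F = -((1 - 2 * s) * ∫ p, score y (z - w) p ∂F) := by
    simp_rw [hyx, score_smul, score_neg y w z]
    rw [integral_const_mul, integral_neg]
    ring
  have h6 : ∑ j, score x (y - x) (X j) = (1 - 2 * s) * ∑ j, score x (w - z) (X j) := by
    simp_rw [hyx, score_smul]
    rw [Finset.mul_sum]
  have h7 : dot d (z - w) = -dot d (w - z) := by simp only [dot_sub]; ring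
  have hs3 : 0 ≤ 1 - 2 * s := by linarith
  have h8 := mul_le_mul_of_nonneg_left h1 hs3
  have h9 := mul_le_mul_of_nonneg_left h2 hs3
  have h10 := mul_le_mul_of_nonneg_left hcd hs3
  have h11 : (1 - 2 * s) * (n * e) ≤ n * e :=
    mul_le_of_le_one_left (by positivity) (by linarith)
  have h12 : n * G ≤ n * (e + a + 2 * l * V) := by
    rw [hG, h5, mul_sub]
    rw [h7] at h8
    have := mul_le_mul_of_nonneg_left h8 hn.le
    linarith
  have h13 : G ≤ e + a + 2 * l * V := le_of_mul_le_mul_left h12 hn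
  have h14 : 2 * l * V ≤ 2 * l * (K * G ^ θ) := by gcongr
  linarith

/-- Absorption of a sublinear power of the unknown. -/
lemma le_of_le_add_mul_rpow {G a b E θ : ℝ} (hG : 0 ≤ G) (hE : 0 < E) (hθ0 : 0 ≤ θ)
    (hθ1 : θ ≤ 1) (hb : b ≤ 1 / 2 * E ^ (1 - θ)) (h : G ≤ a + b * G ^ θ) :
    G ≤ 2 * a + E := by
  have h1 : E ^ (1 - θ) * G ^ θ ≤ (1 - θ) * E + θ * G :=
    Real.geom_mean_le_arith_mean2_weighted (by linarith) hθ0 hE.le hG (by ring)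
  have h2 : b * G ^ θ ≤ 1 / 2 * E ^ (1 - θ) * G ^ θ := by gcongr
  nlinarith

lemma continuousOn_cdf_of_holder {ρ : Measure ℝ} {c ν : ℝ} (hν : 0 < ν)
    (h : ∀ z₁ z₂ : ℝ, 0 ≤ z₁ → z₁ < z₂ → cdf ρ z₂ - cdf ρ z₁ ≤ c * (z₂ - z₁) ^ ν) :
    ContinuousOn (cdf ρ) (Set.Ici 0) := by
  intro z hz
  have hlim : Filter.Tendsto (fun w : ℝ => c * |w - z| ^ ν) (nhds z) (nhds 0) := by
    have hc : Continuous fun w : ℝ => c * |w - z| ^ ν :=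
      continuous_const.mul ((continuous_abs.comp (continuous_id.sub continuous_const)).rpow_const
        fun _ => Or.inr hν.le)
    have := hc.tendsto z
    simpa [Real.zero_rpow hν.ne'] using this
  refine tendsto_iff_dist_tendsto_zero.2 (squeeze_zero' (Filter.Eventually.of_forall fun _ =>
    dist_nonneg) ?_ (hlim.mono_left nhdsWithin_le_nhds))
  filter_upwards [self_mem_nhdsWithin] with w hw
  rw [Real.dist_eq]
  rcases lt_trichotomy z w with hlt | heq | hlt
  · rw [abs_of_nonneg (by linarith [monotone_cdf ρ hlt.le]), abs_of_pos (sub_pos.2 hlt)]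
    exact h z w hz hlt
  · subst heq
    simp [Real.zero_rpow hν.ne']
  · rw [abs_sub_comm, abs_sub_comm w,
      abs_of_nonneg (by linarith [monotone_cdf ρ hlt.le]), abs_of_pos (sub_pos.2 hlt)]
    exact h w z hw hlt

end Optimality

section Concentration

lemma inventory_nonneg {m : ℕ} {b : Vec m} (hb : ∀ i, 0 ≤ b i) (req : ℕ → Vec m × ℝ)
    (lam : ℕ → Vec m) (s : ℕ) : ∀ i, 0 ≤ inventory b req lam s i := by
  induction s with
  | zero => exact hb
  | succ s ih =>
    intro i
    rw [inventory]
    split_ifs with h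
    · simpa using h.2 i
    · exact ih i

lemma ProbAtLeast.of_ae {Ω : Type*} [MeasurableSpace Ω] {P : Measure Ω} [IsProbabilityMeasure P]
    {p : ℝ} {Q : Ω → Prop} {G : Set Ω} (hG : MeasurableSet G) (hp : p ≤ P.real G)
    (h : ∀ᵐ ω ∂P, ω ∈ G → Q ω) : ProbAtLeast P p Q := by
  obtain ⟨N, hN, hNm, hN0⟩ := exists_measurable_superset_of_null (ae_iff.1 h)
  refine ⟨G \ N, hG.diff hNm, ?_, fun ω hω => ?_⟩
  · rwa [measureReal_def, measure_sdiff_null hN0]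
  · by_contra hcon
    exact hω.2 (hN fun hQ => hcon (hQ hω.1))

/-- The number of functions in the grid family is polynomial in `n`. -/
lemma card_grid_le {m k : ℕ} {R c D n : ℝ} (hR : 0 ≤ R) (hc : 0 ≤ c) (hD : 1 ≤ D) (hn : 1 ≤ n) :
    (Fintype.card (((Fin m → Fin (⌊R / (((n * D) ^ k)⁻¹ / (c + 1))⌋₊ + 1)) ×
      (Fin m → Fin (⌊R / (((n * D) ^ k)⁻¹ / (c + 1))⌋₊ + 1))) ⊕
      (Fin m → Fin (⌊R / (((n * D) ^ k)⁻¹ / (c + 1))⌋₊ + 1))) : ℝ) ≤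
    2 * (R * (c + 1) * D ^ k + 1) ^ (2 * m) * n ^ (2 * m * k) := by
  set N := ⌊R / (((n * D) ^ k)⁻¹ / (c + 1))⌋₊
  have hnD : 0 < n * D := by positivity
  have hN : ((N + 1 : ℕ) : ℝ) ≤ (R * (c + 1) * D ^ k + 1) * n ^ k := by
    have h1 : (N : ℝ) ≤ R / (((n * D) ^ k)⁻¹ / (c + 1)) := Nat.floor_le (by positivity)
    have h2 : R / (((n * D) ^ k)⁻¹ / (c + 1)) = R * (c + 1) * D ^ k * n ^ k := by
      rw [mul_pow]
      field_simp
    have h3 : 1 ≤ n ^ k := one_le_pow₀ hn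
    push_cast
    linarith
  have h1 : (1 : ℝ) ≤ ((N + 1 : ℕ) : ℝ) := by push_cast; linarith [Nat.cast_nonneg (α := ℝ) N]
  simp only [Fintype.card_sum, Fintype.card_prod, Fintype.card_fun, Fintype.card_fin]
  calc (((N + 1) ^ m * (N + 1) ^ m + (N + 1) ^ m : ℕ) : ℝ)
      ≤ 2 * ((N + 1 : ℕ) : ℝ) ^ (2 * m) := by
        have h2 : (1 : ℝ) ≤ ((N + 1 : ℕ) : ℝ) ^ m := one_le_pow₀ h1
        push_cast at h2 ⊢
        rw [two_mul m, pow_add]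
        nlinarith
    _ ≤ 2 * ((R * (c + 1) * D ^ k + 1) * n ^ k) ^ (2 * m) := by gcongr
    _ = _ := by rw [mul_pow, ← pow_mul, mul_comm k (2 * m), ← mul_assoc]

lemma card_mul_exp_le {Q n : ℝ} {j : ℕ} (hQ : 1 ≤ Q) (hn : 0 < n) (hlog : 1 ≤ Real.log n) :
    Q * n ^ j * Real.exp (-((j + 2 + Real.log Q) * Real.log n)) ≤
      9 * 1 * Real.log n / n ^ 2 := by
  have hQ0 : 0 < Q := by linarith
  have h1 : Real.exp (-((j + 2 + Real.log Q) * Real.log n)) ≤ (n ^ j)⁻¹ * (n ^ 2)⁻¹ * Q⁻¹ := by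
    have h2 : (n ^ j)⁻¹ * (n ^ 2)⁻¹ * Q⁻¹ =
        Real.exp (-((j + 2) * Real.log n + Real.log Q)) := by
      rw [Real.exp_neg, Real.exp_add, Real.exp_log hQ0, add_mul, Real.exp_add, mul_inv, mul_inv,
        Real.exp_nat_mul, Real.exp_log hn]
      congr 3
      rw [show (2 : ℝ) = ((2 : ℕ) : ℝ) by norm_num, Real.exp_nat_mul, Real.exp_log hn]
    rw [h2]
    have := Real.log_nonneg hQ
    gcongr
    nlinarith
  calc Q * n ^ j * Real.exp (-((j + 2 + Real.log Q) * Real.log n))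
      ≤ Q * n ^ j * ((n ^ j)⁻¹ * (n ^ 2)⁻¹ * Q⁻¹) := by gcongr
    _ = 1 / n ^ 2 := by field_simp
    _ ≤ 9 * 1 * Real.log n / n ^ 2 := by gcongr; linarith

set_option maxHeartbeats 1000000 in
/-- The concentration bounds follow from a variance bound for the scores in terms of the gap. -/
theorem exists_concentrationBounds (m : ℕ) {A Abar rbar ν cν β K : ℝ} (hA : 0 < A)
    (hAA : A ≤ Abar) (hr : 0 < rbar) (hν : 0 < ν) (hβ : 0 ≤ β) (hK : 0 < K) :
    ∃ C₄ : ℝ, 0 < C₄ ∧ ∀ (F : Measure (Vec m × ℝ)) [IsProbabilityMeasure F]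
      (κ : Kernel (Vec m) ℝ) [IsMarkovKernel κ] [F.IsCondKernel κ],
      BoundedRequests A Abar rbar F →
      (∀ a ∈ F.fst.support, ∀ z₁ z₂ : ℝ, 0 ≤ z₁ → z₁ < z₂ →
        cdf (κ a) z₂ - cdf (κ a) z₁ ≤ cν * (z₂ - z₁) ^ ν) →
      (∀ x y : Vec m, InBox 0 (rbar / A) x → InBox 0 (rbar / A) y →
        ∫ p, score x (y - x) p ^ 2 ∂F ≤ K * dualGap F κ y x ^ (2 / (2 + β))) →
      ConcentrationBounds 1 1 C₄ (rbar / A) β F κ := by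
  have hAbar : 0 < Abar := hA.trans_le hAA
  set R := rbar / A with hRdef
  have hR : 0 < R := by positivity
  set M : ℝ := m * Abar * R with hMdef
  have hM : 0 ≤ M := by positivity
  set k : ℕ := ⌈1 / ν⌉₊ with hkdef
  have hk1 : 1 ≤ k := Nat.ceil_pos.2 (by positivity)
  have hkν : 1 ≤ k * ν := by
    rw [← div_le_iff₀ hν]; exact Nat.le_ceil _
  set D : ℝ := max 1 cν with hDdef
  have hD1 : 1 ≤ D := le_max_left _ _
  have hDc : cν ≤ D := le_max_right _ _
  set Q : ℝ := 2 * (R * (m * Abar + 1) * D ^ k + 1) ^ (2 * m) with hQdef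
  have hQ : 1 ≤ Q := by
    have : 1 ≤ (R * (m * Abar + 1) * D ^ k + 1) ^ (2 * m) :=
      one_le_pow₀ (by linarith [show 0 ≤ R * (m * Abar + 1) * D ^ k by positivity])
    linarith
  set L : ℝ := ((2 * m * k : ℕ) : ℝ) + 2 + Real.log Q with hLdef
  have hL : 0 < L := by
    have := Real.log_nonneg hQ
    positivity
  set κ₀ : ℝ := (1 + M + 4 * K)⁻¹ with hκ₀def
  have hden : 0 < 1 + M + 4 * K := by positivity
  have hκ₀ : 0 < κ₀ := inv_pos.2 hden
  have hκ₀mul : κ₀ * (1 + M + 4 * K) = 1 := inv_mul_cancel₀ hden.ne'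
  have hκ₀1 : κ₀ ≤ 1 := by nlinarith
  have hκ₀M : κ₀ * M ≤ 1 := by nlinarith
  have hκ₀K : 2 * κ₀ * K ≤ 1 / 2 := by nlinarith
  refine ⟨2 * ((1 + M) * (L / κ₀) + (4 * M ^ 2 + 4 * M + 6)) + 1, by positivity, ?_⟩
  intro F _ κ _ _ hF hH hvar Ω _ P _ T t b req lamFluid lamStar lamBar hb hlaw hindep ht hT
    hrun hstar hbar
  set n : ℝ := (T : ℝ) - t with hndef
  have hn1 : Real.exp 1 ≤ n := le_trans (by gcongr; norm_num) hT
  have hn2 : 2 ≤ n := by linarith [Real.add_one_le_exp 1]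
  have hn0 : 0 < n := by linarith
  have hlog : 1 ≤ Real.log n := (Real.le_log_iff_exp_le hn0).2 hn1
  have htT : t < T := by
    have : (t : ℝ) < T := by linarith
    exact_mod_cast this
  set ε : ℝ := Real.log n / n with hεdef
  have hε0 : 0 < ε := by positivity
  have hε1 : ε ≤ 1 := by
    rw [hεdef, div_le_one hn0]
    linarith [Real.log_le_sub_one_of_pos hn0]
  have hnε : 1 / n ≤ ε := by rw [hεdef]; gcongr
  set E : ℝ := ε ^ ((2 + β) / (2 + 2 * β)) with hEdef
  have hE0 : 0 < E := Real.rpow_pos_of_pos hε0 _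
  have hE1 : E ≤ 1 := Real.rpow_le_one hε0.le hε1 (by positivity)
  have hεE : ε ≤ E := by
    have h := Real.rpow_le_rpow_of_exponent_ge hε0 hε1
      (show (2 + β) / (2 + 2 * β) ≤ 1 by rw [div_le_one (by positivity)]; linarith)
    rwa [Real.rpow_one] at h
  set θ : ℝ := 2 / (2 + β) with hθdef
  have hθ0 : 0 ≤ θ := by positivity
  have hθ1 : θ ≤ 1 := by rw [hθdef, div_le_one (by positivity)]; linarith
  have hEpow : E * E ^ (1 - θ) = ε := by
    rw [hEdef, ← Real.rpow_mul hε0.le, ← Real.rpow_add hε0]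
    conv_rhs => rw [← Real.rpow_one ε]
    congr 1
    rw [hθdef]
    field_simp
    ring
  set l : ℝ := κ₀ * E ^ (1 - θ) with hldef
  have hEθ0 : 0 < E ^ (1 - θ) := Real.rpow_pos_of_pos hE0 _
  have hEθ1 : E ^ (1 - θ) ≤ 1 := Real.rpow_le_one hE0.le hE1 (by linarith)
  have hl0 : 0 < l := by positivity
  have hlκ : l ≤ κ₀ := mul_le_of_le_one_right hκ₀.le hEθ1
  have hl1 : l ≤ 1 := hlκ.trans hκ₀1
  have hlM : l * M ≤ 1 := (mul_le_mul_of_nonneg_right hlκ hM).trans hκ₀M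
  have hτ : L * ε / l = L / κ₀ * E := by
    rw [hldef, ← hEpow]
    field_simp
  -- the grid
  set η : ℝ := ((n * D) ^ k)⁻¹ with hηdef
  have hnD : n ≤ n * D := le_mul_of_one_le_right hn0.le hD1
  have hnD1 : 1 ≤ n * D := by linarith
  have hη0 : 0 < η := by positivity
  have hηn : η ≤ 1 / n := by
    rw [hηdef, one_div]
    refine inv_anti₀ hn0 (hnD.trans ?_)
    exact le_self_pow₀ hnD1 (by omega)
  set δ : ℝ := η / (m * Abar + 1) with hδdef
  have hδ0 : 0 < δ := by positivity
  have hδη : m * Abar * δ ≤ η := by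
    rw [hδdef, mul_div_assoc', div_le_iff₀ (by positivity)]
    linarith
  have hην : cν * η ^ ν ≤ 1 / n := by
    have h1 : η ^ ν ≤ (n * D)⁻¹ := by
      rw [hηdef, ← Real.rpow_natCast, ← Real.rpow_neg (by positivity), ← Real.rpow_mul
        (by positivity), ← Real.rpow_neg_one]
      exact Real.rpow_le_rpow_of_exponent_le hnD1 (by linarith)
    calc cν * η ^ ν ≤ D * (n * D)⁻¹ := by gcongr
      _ = 1 / n := by field_simp
  have hband : ∀ x : Vec m, InBox 0 R x → ∫ p, band x η p ∂F ≤ 1 / n := fun x hx =>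
    hF.integral_band_le (κ := κ) hx hη0.le fun a ha z hz => by
      have := hH a ha z (z + η) hz (by linarith)
      rw [add_sub_cancel_left] at this
      exact this.trans hην
  have hcont : ∀ a ∈ F.fst.support, ContinuousOn (cdf (κ a)) (Set.Ici 0) := fun a ha =>
    continuousOn_cdf_of_holder hν (hH a ha)
  -- the sample
  let X : Finset.Icc (t + 1) T → Ω → Vec m × ℝ := fun j => req j
  have hsub : ∀ j ∈ Finset.Icc (t + 1) T, j ∈ Finset.Icc 1 T := fun j hj => by
    simp only [Finset.mem_Icc] at hj ⊢; omega
  have hXlaw : ∀ j, HasLaw (X j) F P := fun j => hlaw j (hsub j j.2)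
  have hXind : iIndepFun X P :=
    hindep.precomp (g := fun j : Finset.Icc (t + 1) T => (⟨j, hsub j j.2⟩ : Finset.Icc 1 T))
      fun i j h => Subtype.ext (congrArg (fun u : Finset.Icc 1 T => (u : ℕ)) h)
  have hcard : (Fintype.card (Finset.Icc (t + 1) T) : ℝ) = n := by
    rw [Fintype.card_coe, Nat.card_Icc, show T + 1 - (t + 1) = T - t by omega,
      Nat.cast_sub htT.le]
  have : Nonempty (Finset.Icc (t + 1) T) := ⟨⟨T, by simp only [Finset.mem_Icc]; omega⟩⟩
  obtain ⟨G, hGm, hGp, hG⟩ := exists_uniform_deviation hXlaw hXind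
    (measurable_gridFamily (m := m) (⌊R / δ⌋₊ + 1) δ η) (s := L * ε) hl0
    (hF.abs_mul_gridFamily_le hR.le hδ0 hl0 hl1 hlM)
  rw [hcard] at hGp
  have hprob : 1 - 9 * 1 * Real.log n / n ^ 2 ≤ P.real G := by
    refine le_trans ?_ hGp
    have h1 : n * (L * ε) = L * Real.log n := by
      rw [hεdef]; field_simp
    rw [h1]
    have h2 := card_grid_le (m := m) (k := k) (c := m * Abar) hR.le (by positivity) hD1
      (by linarith : 1 ≤ n)
    have h3 := card_mul_exp_le (j := 2 * m * k) hQ hn0 hlog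
    have h4 := mul_le_mul_of_nonneg_right h2 (Real.exp_pos (-(L * Real.log n))).le
    exact sub_le_sub_left (h4.trans h3) 1
  have key : ∀ ω ∈ G,
      (∀ j ∈ Finset.Icc 1 T, InBox A Abar (req j ω).1 ∧ (req j ω).2 ∈ Set.Icc 0 rbar) →
      ∀ c w z b' : Vec m, (∀ i, 0 ≤ b' i) → (∀ i, 0 ≤ c i) →
      IsDualOptimum R (fluidDual F) (n⁻¹ • b') w →
      IsDualOptimum R (hindsightDual (fun j => req j ω) t T) c z →
      (∀ x y : Vec m, InBox 0 R x → InBox 0 R y → dot c (y - x) - dot b' (y - x) ≤ M) →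
      dualGap F κ w z ≤
        (2 * ((1 + M) * (L / κ₀) + (4 * M ^ 2 + 4 * M + 6)) + 1) * E := by
    intro ω hω hreq c w z b' hb' hc hw hz hcb
    have hwB : InBox 0 R w := hw.inBox_of_fluid hF fun i => by
      simpa using mul_nonneg (inv_nonneg.2 hn0.le) (hb' i)
    have hzB : InBox 0 R z :=
      hz.inBox_of_hindsight hA hr.le (fun j hj => hreq j (hsub j hj)) hc
    refine hF.dualGap_le_of_minimizers (ι := Finset.Icc (t + 1) T) (X := fun j => req j ω) (c := c)
      (a := (1 + M) * (L * ε / l) + (4 * M ^ 2 + 3 * M + 6) * (1 / n)) (e := M * (1 / n))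
      (θ := θ) (K := K) hcont hwB hzB hw.2.1 ?_ (by positivity) ?_ ?_ hl0.le hvar ?_
    · intro y hy
      have := hz.2.1 y hy
      simp only [hindsightDual] at this
      rw [← Finset.sum_coe_sort (Finset.Icc (t + 1) T), ← Finset.sum_coe_sort
        (Finset.Icc (t + 1) T)] at this
      exact this
    · rw [hcard, smul_dot, mul_inv_cancel_left₀ hn0.ne', mul_one_div, mul_div_cancel₀ _ hn0.ne']
      exact hcb z w hzB hwB
    · intro x y hx hy
      have := hF.uniform_deviation hR.le (X := fun j : Finset.Icc (t + 1) T => req j ω)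
        (fun j => (hreq j (hsub j j.2)).1) hδ0 hη0.le hδη hηn
        (by rw [div_le_one hn0]; linarith) hl0 hl1 hband (hG ω hω) hx hy
      refine this.trans (le_of_eq ?_)
      ring
    · intro g hg hle
      have h1 := le_of_le_add_mul_rpow (b := 2 * l * K) hg hE0 hθ0 hθ1
        (by
          have : 2 * l * K = 2 * κ₀ * K * E ^ (1 - θ) := by rw [hldef]; ring
          rw [this]
          gcongr) (by linarith : g ≤ (M * (1 / n) + ((1 + M) * (L * ε / l) +
            (4 * M ^ 2 + 3 * M + 6) * (1 / n))) + 2 * l * K * g ^ θ)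
      refine h1.trans ?_
      rw [hτ]
      have h2 : (4 * M ^ 2 + 4 * M + 6) * (1 / n) ≤ (4 * M ^ 2 + 4 * M + 6) * E := by
        gcongr
        exact hnε.trans hεE
      linarith
  have hreq : ∀ᵐ ω ∂P, ∀ j ∈ Finset.Icc 1 T,
      InBox A Abar (req j ω).1 ∧ (req j ω).2 ∈ Set.Icc 0 rbar := by
    refine (Finset.eventually_all _).2 fun j hj => ?_
    have h := hF.ae_mem
    rw [← (hlaw j hj).map_eq] at h
    exact ae_of_ae_map (hlaw j hj).aemeasurable h
  have ht1 : t ∈ Finset.Icc 1 T := by simp only [Finset.mem_Icc]; omega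
  constructor
  · refine ProbAtLeast.of_ae hGm hprob ?_
    filter_upwards [hrun, hstar, hreq] with ω h1 h2 h3 hω
    have hinv := inventory_nonneg hb (fun j => req j ω) (fun j => lamFluid j ω) (t - 1)
    refine key ω hω h3 _ _ _ _ hinv hinv (h1 t ht le_rfl) h2 fun x y _ _ => ?_
    rw [sub_self]; exact hM
  · refine ProbAtLeast.of_ae hGm hprob ?_
    filter_upwards [hrun, hbar, hreq] with ω h1 h2 h3 hω hfit
    have hinv := inventory_nonneg hb (fun j => req j ω) (fun j => lamFluid j ω) (t - 1)
    refine key ω hω h3 _ _ _ _ hinv (fun i => ?_) (h1 t ht le_rfl) (h2 hfit) fun x y hx hy => ?_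
    · simpa using hfit i
    · rw [sub_dot]
      have := (abs_le.1 ((h3 t ht1).1.abs_dot_sub_le hA hx hy)).1
      linarith

end Concentration

section Holder

variable {β ν cν cβ l u : ℝ} {ρ : Measure ℝ}

lemma cdf_eq_one_of_support_subset [IsProbabilityMeasure ρ] (h : ρ.support ⊆ Set.Iic u) :
    cdf ρ u = 1 := by
  rw [cdf_eq_real, ← probReal_univ (μ := ρ)]
  refine measureReal_congr (Filter.eventuallyEq_univ.2 ?_)
  exact Filter.mem_of_superset Measure.support_mem_ae h

lemma cdf_eq_zero_of_support_subset [IsProbabilityMeasure ρ] (h : ρ.support ⊆ Set.Ici l)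
    (hl : ρ {l} = 0) : cdf ρ l = 0 := by
  have h0 : ρ (Set.Iic l) = 0 := by
    rw [← Set.Iio_union_right]
    have hsub : Set.Iio l ⊆ ρ.supportᶜ := fun z hz hmem =>
      (Set.mem_Iio.1 hz).not_ge (h hmem)
    exact measure_union_null (measure_mono_null hsub Measure.measure_compl_support) hl
  rw [cdf_eq_real, measureReal_def, h0, ENNReal.toReal_zero]

/-- The Hölder bound extends beyond the support of the reward. -/
lemma HolderCDF.sub_le (h : HolderCDF β ν cν cβ ρ l u) (hν : 0 < ν) (hcν : 0 < cν)
    (hu : cdf ρ u = 1) {z₁ z₂ : ℝ} (hz : l ≤ z₁ ∨ cdf ρ l = 0) (h12 : z₁ < z₂) :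
    cdf ρ z₂ - cdf ρ z₁ ≤ cν * (z₂ - z₁) ^ ν := by
  have hpos : 0 ≤ cν * (z₂ - z₁) ^ ν :=
    mul_nonneg hcν.le (Real.rpow_nonneg (by linarith) _)
  have hle : cdf ρ z₂ ≤ cdf ρ (min z₂ u) := by
    rcases le_total z₂ u with h' | h'
    · rw [min_eq_left h']
    · rw [min_eq_right h', hu]; exact cdf_le_one _ _
  have hge : cdf ρ (max z₁ l) ≤ cdf ρ z₁ := by
    rcases le_total l z₁ with h' | h'
    · rw [max_eq_left h']
    · rw [max_eq_right h']
      rcases hz with h'' | h''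
      · rw [le_antisymm h' h'']
      · rw [h'']; exact cdf_nonneg _ _
  rcases lt_or_ge (max z₁ l) (min z₂ u) with hlt | hlt
  · have h1 := (h _ _ (le_max_right _ _) hlt (min_le_right _ _)).2
    have h2 : (min z₂ u - max z₁ l) ^ ν ≤ (z₂ - z₁) ^ ν := by
      refine Real.rpow_le_rpow (by linarith) ?_ hν.le
      linarith [min_le_left z₂ u, le_max_left z₁ l]
    have h3 := mul_le_mul_of_nonneg_left h2 hcν.le
    linarith
  · linarith [monotone_cdf ρ hlt]

/-- The reward intervals have a minimal length. -/
lemma HolderCDF.le_sub (h : HolderCDF β ν cν cβ ρ l u) (hν : 0 < ν) (hcν : 0 < cν)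
    (hlu : l ≤ u) (hl : cdf ρ l = 0) (hu : cdf ρ u = 1) : (1 / cν) ^ (1 / ν) ≤ u - l := by
  rcases hlu.eq_or_lt with heq | hlt
  · rw [heq, hu] at hl; norm_num at hl
  have h1 := (h l u le_rfl hlt le_rfl).2
  rw [hl, hu, sub_zero] at h1
  have h2 : 1 / cν ≤ (u - l) ^ ν := by
    rw [div_le_iff₀ hcν]; linarith
  calc (1 / cν) ^ (1 / ν) ≤ ((u - l) ^ ν) ^ (1 / ν) :=
        Real.rpow_le_rpow (by positivity) h2 (by positivity)
    _ = u - l := by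
        rw [← Real.rpow_mul (by linarith), mul_one_div_cancel hν.ne', Real.rpow_one]

lemma sq_le_rpow_of_rpow_le {c t g : ℝ} (hβ : 0 ≤ β) (hc : 0 < c) (ht : 0 ≤ t)
    (h : c * t ^ (2 + β) ≤ g) :
    t ^ 2 ≤ (c ^ (2 / (2 + β)))⁻¹ * g ^ (2 / (2 + β)) := by
  have h1 : (c * t ^ (2 + β)) ^ (2 / (2 + β)) ≤ g ^ (2 / (2 + β)) :=
    Real.rpow_le_rpow (by positivity) h (by positivity)
  rw [Real.mul_rpow hc.le (by positivity), ← Real.rpow_mul ht,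
    mul_div_cancel₀ _ (by positivity : (2 + β) ≠ 0), Real.rpow_two] at h1
  have h2 : 0 < c ^ (2 / (2 + β)) := Real.rpow_pos_of_pos hc _
  rw [← div_eq_inv_mul, le_div_iff₀ h2]
  linarith

lemma mul_rpow_self {t : ℝ} (ht : 0 ≤ t) (hβ : 0 ≤ β) : t ^ (1 + β) * t = t ^ (2 + β) := by
  rw [show 2 + β = (1 + β) + 1 by ring, Real.rpow_add_one' ht (by positivity)]

/-- Above the left end point of the reward interval, the variance of the score is controlled
by the gap. -/
lemma HolderCDF.variance_le (h : HolderCDF β ν cν cβ ρ l u) (hβ : 0 ≤ β) (hcβ : 0 < cβ)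
    (hu : cdf ρ u = 1) {z w M : ℝ} (hz : l ≤ z) (hw : l ≤ w) (hM : |w - z| ≤ M) :
    (1 - cdf ρ z) * (w - z) ^ 2 ≤
      ((cβ ^ (2 / (2 + β)))⁻¹ + M * M ^ (1 - 2 / (2 + β))) *
        ((cdf ρ w - cdf ρ z) * (w - z)) ^ (2 / (2 + β)) := by
  set g := (cdf ρ w - cdf ρ z) * (w - z) with hg
  set θ := 2 / (2 + β)
  have hθ1 : θ ≤ 1 := by
    rw [div_le_one (by positivity)]; linarith
  have hM0 : 0 ≤ M := (abs_nonneg _).trans hM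
  have hg0 : 0 ≤ g := dualGap_integrand_nonneg ρ w z
  have hF0 := cdf_nonneg ρ z
  have hF1 := cdf_le_one ρ z
  have hnn : 0 ≤ M * M ^ (1 - θ) * g ^ θ := by positivity
  have hnn' : 0 ≤ (cβ ^ θ)⁻¹ * g ^ θ := by positivity
  rw [add_mul]
  rcases le_or_gt u z with huz | huz
  · have : cdf ρ z = 1 := le_antisymm hF1 (hu ▸ monotone_cdf ρ huz)
    rw [this, sub_self, zero_mul]
    linarith
  rcases le_or_gt w u with hwu | hwu
  · have hlow : cβ * |w - z| ^ (2 + β) ≤ g := by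
      rw [← mul_rpow_self (abs_nonneg _) hβ]
      rcases lt_trichotomy z w with hlt | heq | hlt
      · have h1 := (h z w hz hlt hwu).1
        rw [abs_of_pos (sub_pos.2 hlt), ← mul_assoc]
        exact mul_le_mul_of_nonneg_right h1 (by linarith)
      · rw [heq]; simp [hg, heq]
      · have h1 := (h w z hw hlt huz.le).1
        rw [abs_sub_comm, abs_of_pos (sub_pos.2 hlt), ← mul_assoc, hg]
        have := mul_le_mul_of_nonneg_right h1 (sub_pos.2 hlt).le
        linarith
    have h2 := sq_le_rpow_of_rpow_le hβ hcβ (abs_nonneg (w - z)) hlow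
    rw [sq_abs] at h2
    have h3 : (1 - cdf ρ z) * (w - z) ^ 2 ≤ (w - z) ^ 2 :=
      mul_le_of_le_one_left (sq_nonneg _) (by linarith)
    linarith
  · have hFw : cdf ρ w = 1 := le_antisymm (cdf_le_one _ _) (hu ▸ monotone_cdf ρ hwu.le)
    have hwz : 0 < w - z := by linarith
    rw [abs_of_pos hwz] at hM
    have hgM : g ≤ M := by
      rw [hg, hFw]
      exact (mul_le_of_le_one_left hwz.le (by linarith)).trans hM
    have h1 : (1 - cdf ρ z) * (w - z) ^ 2 = g * (w - z) := by rw [hg, hFw]; ring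
    have h2 : g ≤ M ^ (1 - θ) * g ^ θ := by
      rcases hg0.eq_or_lt with h0 | hpos
      · rw [← h0]; positivity
      calc g = g ^ (1 - θ) * g ^ θ := by rw [← Real.rpow_add hpos]; simp
        _ ≤ M ^ (1 - θ) * g ^ θ := by gcongr
    have h3 : g * (w - z) ≤ M ^ (1 - θ) * g ^ θ * M := by gcongr
    rw [h1]
    linarith

/-- Around an interior point of the reward interval, the gap controls the price difference. -/
lemma HolderCDF.gap_ge (h : HolderCDF β ν cν cβ ρ l u) (hβ : 0 ≤ β)
    {z w q M : ℝ} (hq : 0 < q) (hz : l ≤ z) (hzu : z + q ≤ u) (hw : l ≤ w ∨ l ≤ z - q)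
    (hM : |w - z| ≤ M) :
    cβ * (q / (q + M)) ^ (1 + β) * |w - z| ^ (2 + β) ≤ (cdf ρ w - cdf ρ z) * (w - z) := by
  have hM0 : 0 ≤ M := (abs_nonneg _).trans hM
  set c := q / (q + M) with hc
  have hc0 : 0 < c := by positivity
  have hc1 : c ≤ 1 := by rw [hc, div_le_one (by positivity)]; linarith
  have hcM : c * M ≤ q := by
    rw [hc, div_mul_eq_mul_div, div_le_iff₀ (by positivity)]; nlinarith
  have key : ∀ t : ℝ, 0 ≤ t → cβ * c ^ (1 + β) * t ^ (2 + β) = cβ * (c * t) ^ (1 + β) * t := by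
    intro t ht
    rw [← mul_rpow_self ht hβ, Real.mul_rpow hc0.le ht]
    ring
  rw [key _ (abs_nonneg _)]
  rcases lt_trichotomy z w with hlt | heq | hlt
  · rw [abs_of_pos (sub_pos.2 hlt)] at hM ⊢
    have hwz := sub_pos.2 hlt
    have h1 : c * (w - z) ≤ w - z := mul_le_of_le_one_left hwz.le hc1
    have h2 : c * (w - z) ≤ q := (mul_le_mul_of_nonneg_left hM hc0.le).trans hcM
    have h3 := (h z (z + c * (w - z)) hz (by linarith [mul_pos hc0 hwz]) (by linarith)).1
    rw [add_sub_cancel_left] at h3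
    have h4 := monotone_cdf ρ (by linarith : z + c * (w - z) ≤ w)
    exact mul_le_mul_of_nonneg_right (by linarith) hwz.le
  · subst heq; simp
  · rw [abs_sub_comm, abs_of_pos (sub_pos.2 hlt)] at hM ⊢
    have hwz := sub_pos.2 hlt
    have h1 : c * (z - w) ≤ z - w := mul_le_of_le_one_left hwz.le hc1
    have h2 : c * (z - w) ≤ q := (mul_le_mul_of_nonneg_left hM hc0.le).trans hcM
    have h3 := (h (z - c * (z - w)) z (by rcases hw with h' | h' <;> linarith)
      (by linarith [mul_pos hc0 hwz]) (by linarith)).1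
    rw [sub_sub_cancel] at h3
    have h4 := monotone_cdf ρ (by linarith : w ≤ z - c * (z - w))
    have h5 := mul_le_mul_of_nonneg_right
      (by linarith : cβ * (c * (z - w)) ^ (1 + β) ≤ cdf ρ z - cdf ρ w) hwz.le
    linarith

end Holder

section Variance

variable {m : ℕ} {A Abar rbar R : ℝ} {F : Measure (Vec m × ℝ)} [IsProbabilityMeasure F]
  {κ : Kernel (Vec m) ℝ} [IsMarkovKernel κ] [F.IsCondKernel κ]

/-- A variance bound for almost every consumption vector gives one on average, by Jensen. -/
lemma BoundedRequests.integral_score_sq_le (hF : BoundedRequests A Abar rbar F) {x y : Vec m}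
    (hx : InBox 0 R x) (hy : InBox 0 R y) {K θ : ℝ} (hK : 0 ≤ K) (hθ0 : 0 ≤ θ) (hθ1 : θ ≤ 1)
    (h : ∀ a ∈ F.fst.support, (1 - cdf (κ a) (dot a x)) * (dot a y - dot a x) ^ 2 ≤
      K * ((cdf (κ a) (dot a y) - cdf (κ a) (dot a x)) * (dot a y - dot a x)) ^ θ) :
    ∫ p, score x (y - x) p ^ 2 ∂F ≤ K * dualGap F κ y x ^ θ := by
  set g : Vec m → ℝ := fun a =>
    (cdf (κ a) (dot a y) - cdf (κ a) (dot a x)) * (dot a y - dot a x) with hg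
  have hg0 : ∀ a, 0 ≤ g a := fun a => dualGap_integrand_nonneg (κ a) _ _
  have hgi : Integrable g F.fst := hF.integrable_dualGap hx hy
  have hgm : Measurable g := measurable_dualGap_integrand x y
  have hpi : Integrable (fun a => g a ^ θ) F.fst := by
    refine Integrable.of_bound (C := (m * Abar * R) ^ θ)
      (hgm.pow_const θ).aestronglyMeasurable (hF.ae_fst.mono fun a ha => ?_)
    rw [Real.norm_eq_abs, abs_of_nonneg (Real.rpow_nonneg (hg0 a) _)]
    refine Real.rpow_le_rpow (hg0 a) ?_ hθ0
    exact (le_abs_self _).trans (ha.2.dualGap_integrand_le _ hF.lower_pos hx hy)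
  have hjensen : ∫ a, g a ^ θ ∂F.fst ≤ (∫ a, g a ∂F.fst) ^ θ :=
    (Real.concaveOn_rpow hθ0 hθ1).le_map_integral
      (Real.continuous_rpow_const hθ0).continuousOn isClosed_Ici
      (Filter.Eventually.of_forall hg0) hgi hpi
  rw [hF.integral_score_sq (κ := κ) x hx hy]
  calc ∫ a, (1 - cdf (κ a) (dot a x)) * dot a (y - x) ^ 2 ∂F.fst
      ≤ ∫ a, K * g a ^ θ ∂F.fst := by
        refine integral_mono_of_nonneg (Filter.Eventually.of_forall fun a =>
          mul_nonneg (sub_nonneg.2 (cdf_le_one _ _)) (sq_nonneg _)) (hpi.const_mul K) ?_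
        filter_upwards [hF.ae_fst] with a ha
        rw [dot_sub]
        exact h a ha.1
    _ = K * ∫ a, g a ^ θ ∂F.fst := integral_const_mul _ _
    _ ≤ K * dualGap F κ y x ^ θ := mul_le_mul_of_nonneg_left hjensen hK

theorem SupportFromZero.integral_score_sq_le {β ν cν cβ : ℝ}
    (h : SupportFromZero A Abar rbar β ν cν cβ F κ) (hR : 0 ≤ R) {x y : Vec m}
    (hx : InBox 0 R x) (hy : InBox 0 R y) :
    ∫ p, score x (y - x) p ^ 2 ∂F ≤
      ((cβ ^ (2 / (2 + β)))⁻¹ +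
        (m * Abar * R) * (m * Abar * R) ^ (1 - 2 / (2 + β))) *
          dualGap F κ y x ^ (2 / (2 + β)) := by
  have hβ := h.β_nonneg
  have hF := h.bounded
  have hcβ := h.cβ_pos
  have hAbar : 0 ≤ Abar := hF.lower_pos.le.trans hF.lower_le_upper
  refine hF.integral_score_sq_le hx hy (by positivity) (by positivity)
    (by rw [div_le_one (by positivity)]; linarith) fun a ha => ?_
  obtain ⟨u, -, hsupp, hH⟩ := h.reward_law a ha
  have haB := hF.inBox_of_mem ha
  have hM := haB.abs_dot_sub_le hF.lower_pos hx hy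
  rw [dot_sub] at hM
  exact hH.variance_le hβ hcβ
    (cdf_eq_one_of_support_subset (hsupp.trans_subset Set.Icc_subset_Iic_self))
    (haB.dot_nonneg hF.lower_pos hx) (haB.dot_nonneg hF.lower_pos hy) hM

omit [IsProbabilityMeasure F] [F.IsCondKernel κ] in
theorem SupportFromZero.cdf_sub_le {β ν cν cβ : ℝ}
    (h : SupportFromZero A Abar rbar β ν cν cβ F κ) :
    ∀ a ∈ F.fst.support, ∀ z₁ z₂ : ℝ, 0 ≤ z₁ → z₁ < z₂ →
      cdf (κ a) z₂ - cdf (κ a) z₁ ≤ cν * (z₂ - z₁) ^ ν := by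
  intro a ha z₁ z₂ h1 h12
  obtain ⟨u, -, hsupp, hH⟩ := h.reward_law a ha
  exact hH.sub_le h.ν_pos h.cν_pos
    (cdf_eq_one_of_support_subset (hsupp.trans_subset Set.Icc_subset_Iic_self)) (.inl h1) h12

end Variance

section Geometry

variable {m : ℕ}

lemma dot_eq_inner (a x : Vec m) : dot a x = inner ℝ a x := by
  simp [dot, PiLp.inner_apply, mul_comm]

lemma abs_dot_le_norm (a x : Vec m) : |dot a x| ≤ ‖a‖ * ‖x‖ := by
  rw [dot_eq_inner]; exact abs_real_inner_le_norm a x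

lemma InBox.norm_le {l u : ℝ} (hl : 0 ≤ l) {x : Vec m} (hx : InBox l u x) :
    ‖x‖ ≤ √(m * u ^ 2) := by
  rw [EuclideanSpace.norm_eq]
  refine Real.sqrt_le_sqrt ?_
  calc ∑ i, ‖x i‖ ^ 2 ≤ ∑ _i : Fin m, u ^ 2 := Finset.sum_le_sum fun i _ => by
        rw [Real.norm_eq_abs, sq_abs]
        exact pow_le_pow_left₀ (hl.trans (hx i).1) (hx i).2 2
    _ = m * u ^ 2 := by simp

/-- A ball contains a smaller one on which a given linear form is large. -/
lemma exists_ball_le_abs_dot (z v : Vec m) {r : ℝ} (hr : 0 < r) :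
    ∃ z', Metric.ball z' (r / 4) ⊆ Metric.ball z r ∧
      ∀ a ∈ Metric.ball z' (r / 4), r / 4 * ‖v‖ ≤ |dot a v| := by
  obtain ⟨w, hw1, hw2⟩ : ∃ w : Vec m, ‖w‖ ≤ 1 ∧ dot w v = ‖v‖ := by
    refine ⟨‖v‖⁻¹ • v, ?_, ?_⟩
    · rw [norm_smul, norm_inv, norm_norm]
      exact inv_mul_le_one
    · rw [smul_dot, dot_eq_inner, real_inner_self_eq_norm_sq]
      rcases eq_or_ne ‖v‖ 0 with h | h
      · rw [h]; simp
      · field_simp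
  obtain ⟨σ, hσ1, hσ2⟩ : ∃ σ : ℝ, |σ| = 1 ∧ 0 ≤ σ * dot z v := by
    rcases le_total 0 (dot z v) with h | h
    · exact ⟨1, by simp, by simpa⟩
    · exact ⟨-1, by simp, by simpa⟩
  have hv := norm_nonneg v
  refine ⟨z + (σ * (r / 2)) • w, fun a ha => ?_, fun a ha => ?_⟩
  · rw [Metric.mem_ball] at ha ⊢
    have h1 : dist (z + (σ * (r / 2)) • w) z ≤ r / 2 := by
      rw [dist_eq_norm, add_sub_cancel_left, norm_smul, Real.norm_eq_abs, abs_mul, hσ1, one_mul,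
        abs_of_pos (by positivity)]
      exact mul_le_of_le_one_right (by positivity) hw1
    linarith [dist_triangle a (z + (σ * (r / 2)) • w) z]
  · rw [Metric.mem_ball, dist_eq_norm] at ha
    set e := a - (z + (σ * (r / 2)) • w) with he
    have h1 : |dot e v| ≤ r / 4 * ‖v‖ :=
      (abs_dot_le_norm e v).trans (mul_le_mul_of_nonneg_right ha.le hv)
    have h2 : dot a v = dot z v + σ * (r / 2) * ‖v‖ + dot e v := by
      rw [he, sub_dot, add_dot, smul_dot, hw2]; ring
    have hσσ : σ * σ = 1 := by rw [← abs_mul_abs_self, hσ1, one_mul]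
    have h3 : σ * dot a v = σ * dot z v + r / 2 * ‖v‖ + σ * dot e v := by
      rw [h2]; linear_combination (r / 2 * ‖v‖) * hσσ
    have h4 : |σ * dot a v| = |dot a v| := by rw [abs_mul, hσ1, one_mul]
    have h5 : |σ * dot e v| = |dot e v| := by rw [abs_mul, hσ1, one_mul]
    rw [← h4, h3]
    refine le_trans ?_ (le_abs_self _)
    linarith [neg_abs_le (σ * dot e v)]

/-- Near every point of a convex body there is a set of substantial volume on which a given
linear form is large. -/
lemma exists_large_linear_form {S : Set (Vec m)} (hconv : Convex ℝ S)
    (hbdd : Bornology.IsBounded S) (hint : (interior S).Nonempty) {ρ : ℝ} (hρ : 0 < ρ) :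
    ∃ c : ℝ, 0 < c ∧ ∀ a₁ ∈ S, ∀ v : Vec m, ∃ E : Set (Vec m), MeasurableSet E ∧
      E ⊆ S ∩ Metric.ball a₁ ρ ∧ ENNReal.ofReal c ≤ volume E ∧ ∀ a ∈ E, c * ‖v‖ ≤ |dot a v| := by
  obtain ⟨p, hp⟩ := hint
  obtain ⟨η, hη, hball⟩ := Metric.isOpen_iff.1 isOpen_interior p hp
  have hball : Metric.ball p η ⊆ S := hball.trans interior_subset
  obtain ⟨d, hd, hdist⟩ : ∃ d : ℝ, 0 < d ∧ ∀ a ∈ S, ∀ b ∈ S, dist a b ≤ d := by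
    obtain ⟨d, hd⟩ := Metric.isBounded_iff.1 hbdd
    exact ⟨max d 1, by positivity, fun a ha b hb => (hd ha hb).trans (le_max_left _ _)⟩
  set θ : ℝ := min 1 (ρ / (2 * d)) with hθ
  have hθ0 : 0 < θ := by positivity
  have hθ1 : θ ≤ 1 := min_le_left _ _
  have hθd : θ * d < ρ := by
    have h1 : θ ≤ ρ / (2 * d) := min_le_right _ _
    rw [le_div_iff₀ (by positivity)] at h1
    linarith
  set r : ℝ := θ * η with hr
  have hr0 : 0 < r := by positivity
  have hvol0 : 0 < volume (Metric.ball (0 : Vec m) (r / 4)) :=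
    Metric.measure_ball_pos _ _ (by positivity)
  have hvolt : volume (Metric.ball (0 : Vec m) (r / 4)) ≠ ⊤ := measure_ball_lt_top.ne
  refine ⟨min (r / 4) (volume (Metric.ball (0 : Vec m) (r / 4))).toReal,
    lt_min (by positivity) (ENNReal.toReal_pos hvol0.ne' hvolt), fun a₁ ha₁ v => ?_⟩
  obtain ⟨z', hz'1, hz'2⟩ := exists_ball_le_abs_dot (a₁ + θ • (p - a₁)) v hr0
  refine ⟨Metric.ball z' (r / 4), measurableSet_ball, fun a ha => ?_, ?_, fun a ha => ?_⟩
  · have h1 := hz'1 ha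
    rw [Metric.mem_ball, dist_eq_norm] at h1
    set e := θ⁻¹ • (a - (a₁ + θ • (p - a₁))) with he
    have he' : ‖e‖ < η := by
      rw [he, norm_smul, norm_inv, Real.norm_eq_abs, abs_of_pos hθ0, ← div_eq_inv_mul,
        div_lt_iff₀ hθ0, mul_comm]
      exact h1
    have hpe : p + e ∈ S := hball (by simpa [Metric.mem_ball, dist_eq_norm] using he')
    have ha_eq : a = a₁ + θ • (p + e - a₁) := by
      rw [add_sub_right_comm, smul_add, he, smul_inv_smul₀ hθ0.ne']
      abel
    refine ⟨?_, ?_⟩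
    · rw [ha_eq]
      exact hconv.add_smul_sub_mem ha₁ hpe ⟨hθ0.le, hθ1⟩
    · rw [Metric.mem_ball, ha_eq, dist_eq_norm, add_sub_cancel_left, norm_smul,
        Real.norm_eq_abs, abs_of_pos hθ0, ← dist_eq_norm]
      exact (mul_le_mul_of_nonneg_left (hdist _ hpe _ ha₁) hθ0.le).trans_lt hθd
  · rw [Measure.addHaar_ball_center volume z']
    exact (ENNReal.ofReal_le_ofReal (min_le_right _ _)).trans (ENNReal.ofReal_toReal hvolt).le
  · exact (mul_le_mul_of_nonneg_right (min_le_left _ _) (norm_nonneg v)).trans (hz'2 a ha)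

/-- A convex compact set that carries an absolutely continuous probability measure is a body. -/
lemma interior_nonempty_of_density {μ : Measure (Vec m)} [IsProbabilityMeasure μ]
    {p : Vec m → ENNReal} (hμ : μ = volume.withDensity p) (hconv : Convex ℝ μ.support) :
    (interior μ.support).Nonempty := by
  by_contra hemp
  rw [Set.not_nonempty_iff_eq_empty] at hemp
  have h1 : frontier μ.support = μ.support := by
    rw [frontier, hemp, Set.sdiff_empty, Measure.isClosed_support.closure_eq]
  have h2 : volume μ.support = 0 := h1 ▸ hconv.addHaar_frontier volume
  have h3 : μ μ.support = 0 := by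
    have hac : μ ≪ volume := hμ ▸ withDensity_absolutelyContinuous _ _
    exact hac h2
  have h4 : μ μ.support = 1 := by
    rw [← measure_univ (μ := μ)]
    exact measure_congr (Filter.eventuallyEq_univ.2 Measure.support_mem_ae)
  rw [h3] at h4
  exact zero_ne_one h4

end Geometry

section LocallyFromZero

variable {m : ℕ} {A Abar rbar R : ℝ} {F : Measure (Vec m × ℝ)} [IsProbabilityMeasure F]
  {κ : Kernel (Vec m) ℝ} [IsMarkovKernel κ]

/-- If the gap controls the price difference near a point of the support, then it controls the
distance of the price vectors. -/
lemma BoundedRequests.dualGap_ge (hF : BoundedRequests A Abar rbar F) {β lf ρ c c₀ : ℝ}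
    (hβ : 0 ≤ β) (hlf : 0 ≤ lf) (hc : 0 ≤ c) (hc₀ : 0 ≤ c₀) {p : Vec m → ENNReal}
    (hp : F.fst = volume.withDensity p)
    (hpl : ∀ a ∈ F.fst.support, ENNReal.ofReal lf ≤ p a) {a₁ x y : Vec m}
    (hx : InBox 0 R x) (hy : InBox 0 R y) {E : Set (Vec m)} (hE : MeasurableSet E)
    (hES : E ⊆ F.fst.support ∩ Metric.ball a₁ ρ) (hvol : ENNReal.ofReal c ≤ volume E)
    (hlin : ∀ a ∈ E, c * ‖y - x‖ ≤ |dot a (y - x)|)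
    (hlow : ∀ a ∈ F.fst.support ∩ Metric.ball a₁ ρ, c₀ * |dot a y - dot a x| ^ (2 + β) ≤
      (cdf (κ a) (dot a y) - cdf (κ a) (dot a x)) * (dot a y - dot a x)) :
    c₀ * c ^ (2 + β) * (lf * c) * ‖y - x‖ ^ (2 + β) ≤ dualGap F κ y x := by
  have hmass : lf * c ≤ F.fst.real E := by
    rw [measureReal_def, ← ENNReal.ofReal_le_iff_le_toReal (measure_ne_top _ _)]
    have h1 : F.fst E = ∫⁻ a in E, p a := by rw [hp, withDensity_apply _ hE]
    calc ENNReal.ofReal (lf * c) = ENNReal.ofReal lf * ENNReal.ofReal c :=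
          ENNReal.ofReal_mul hlf
      _ ≤ ENNReal.ofReal lf * volume E := by gcongr
      _ = ∫⁻ _a in E, ENNReal.ofReal lf := by rw [setLIntegral_const]
      _ ≤ ∫⁻ a in E, p a := setLIntegral_mono' hE fun a ha => hpl a (hES ha).1
      _ = F.fst E := h1.symm
  have hgi := hF.integrable_dualGap (κ := κ) hx hy
  have h1 : ∫ a in E, c₀ * (c * ‖y - x‖) ^ (2 + β) ∂F.fst ≤ ∫ a in E,
      (cdf (κ a) (dot a y) - cdf (κ a) (dot a x)) * (dot a y - dot a x) ∂F.fst := by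
    refine setIntegral_mono_on (integrable_const _).integrableOn hgi.integrableOn hE fun a ha => ?_
    refine le_trans ?_ (hlow a (hES ha))
    rw [← dot_sub]
    have := hlin a ha
    gcongr
  have h2 : ∫ a in E,
      (cdf (κ a) (dot a y) - cdf (κ a) (dot a x)) * (dot a y - dot a x) ∂F.fst ≤
        dualGap F κ y x :=
    setIntegral_le_integral hgi
      (Filter.Eventually.of_forall fun a => dualGap_integrand_nonneg (κ a) _ _)
  rw [setIntegral_const, smul_eq_mul] at h1
  have hn := norm_nonneg (y - x)
  have h3 : lf * c * (c₀ * (c * ‖y - x‖) ^ (2 + β)) ≤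
      F.fst.real E * (c₀ * (c * ‖y - x‖) ^ (2 + β)) := by gcongr
  rw [Real.mul_rpow hc hn] at h1 h3
  linarith

/-- Prices that do not exceed the middle of the reward interval everywhere lie well inside the
reward intervals near some point of the support. -/
lemma exists_interior_price {S : Set (Vec m)} {l u : Vec m → ℝ} {cL : NNReal} {q ρ r₀ B : ℝ}
    {a₀ x : Vec m} (hS : IsPreconnected S) (hl : LipschitzOnWith cL l S)
    (hu : LipschitzOnWith cL u S) (hlen : ∀ a ∈ S, 4 * q ≤ u a - l a) (hq : 0 < q)
    (ha₀ : a₀ ∈ S) (hzero : ∀ a ∈ Metric.ball a₀ r₀ ∩ S, l a = 0) (hρr : ρ ≤ r₀)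
    (hρ : ρ * (B + cL) ≤ q) (hB : ‖x‖ ≤ B) (hpos : ∀ a ∈ S, 0 ≤ dot a x)
    (hx : ∃ a ∈ S, dot a x ≤ (l a + u a) / 2) :
    ∃ a₂ ∈ S, ∀ a ∈ S ∩ Metric.ball a₂ ρ, l a ≤ dot a x ∧ dot a x + q ≤ u a ∧
      ∀ w, 0 ≤ w → l a ≤ w ∨ l a ≤ dot a x - q := by
  by_cases hup : ∃ a ∈ S, (l a + u a) / 2 ≤ dot a x
  · obtain ⟨a₃, ha₃, h₃⟩ := hup
    obtain ⟨a₁, ha₁, h₁⟩ := hx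
    have hcont : ContinuousOn (fun a => dot a x - (l a + u a) / 2) S :=
      (continuous_dot_left x).continuousOn.sub
        ((hl.continuousOn.add hu.continuousOn).div_const 2)
    obtain ⟨a₂, ha₂, h₂⟩ := hS.intermediate_value ha₁ ha₃ hcont
      (show (0 : ℝ) ∈ Set.Icc _ _ from ⟨by linarith, by linarith⟩)
    simp only at h₂
    refine ⟨a₂, ha₂, fun a ha => ?_⟩
    have hdist : dist a a₂ ≤ ρ := (Metric.mem_ball.1 ha.2).le
    have e1 : |dot a x - dot a₂ x| ≤ ρ * B := by
      rw [← sub_dot]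
      refine (abs_dot_le_norm _ _).trans ?_
      rw [← dist_eq_norm]
      exact mul_le_mul hdist hB (norm_nonneg _) (dist_nonneg.trans hdist)
    have e2 : |l a - l a₂| ≤ ρ * cL := by
      have := hl.dist_le_mul a ha.1 a₂ ha₂
      rw [Real.dist_eq] at this
      exact this.trans (by rw [mul_comm]; gcongr)
    have e3 : |u a - u a₂| ≤ ρ * cL := by
      have := hu.dist_le_mul a ha.1 a₂ ha₂
      rw [Real.dist_eq] at this
      exact this.trans (by rw [mul_comm]; gcongr)
    have e4 := hlen a₂ ha₂
    rw [abs_le] at e1 e2 e3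
    refine ⟨by linarith, by linarith, fun w _ => .inr (by linarith)⟩
  · push Not at hup
    refine ⟨a₀, ha₀, fun a ha => ?_⟩
    have h0 : l a = 0 := hzero a ⟨Metric.ball_subset_ball hρr ha.2, ha.1⟩
    have h1 := hup a ha.1
    have h2 := hlen a ha.1
    have h3 := hpos a ha.1
    rw [h0] at h1 h2 ⊢
    exact ⟨h3, by linarith, fun w hw => .inl hw⟩

variable [F.IsCondKernel κ]

lemma BoundedRequests.integral_score_sq_le_norm (hF : BoundedRequests A Abar rbar F)
    {x y : Vec m} (hx : InBox 0 R x) (hy : InBox 0 R y) :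
    ∫ p, score x (y - x) p ^ 2 ∂F ≤ m * Abar ^ 2 * ‖y - x‖ ^ 2 := by
  have h1 : ∫ p, score x (y - x) p ^ 2 ∂F ≤ ∫ _p, m * Abar ^ 2 * ‖y - x‖ ^ 2 ∂F := by
    refine integral_mono_ae (hF.integrable_score_sq x hx hy) (integrable_const _) ?_
    filter_upwards [hF.ae_mem] with p hp
    have e1 := (abs_score_le x (y - x) p).trans (abs_dot_le_norm p.1 (y - x))
    have e2 := hp.1.norm_le hF.lower_pos.le
    have e3 : |score x (y - x) p| ≤ √(m * Abar ^ 2) * ‖y - x‖ :=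
      e1.trans (mul_le_mul_of_nonneg_right e2 (norm_nonneg _))
    calc score x (y - x) p ^ 2 = |score x (y - x) p| ^ 2 := (sq_abs _).symm
      _ ≤ (√(m * Abar ^ 2) * ‖y - x‖) ^ 2 := by gcongr
      _ = m * Abar ^ 2 * ‖y - x‖ ^ 2 := by rw [mul_pow, Real.sq_sqrt (by positivity)]
  simpa using h1

omit [IsProbabilityMeasure F] [F.IsCondKernel κ] in
theorem SupportLocallyFromZero.cdf_sub_le {β ν cν cβ lf r₀ : ℝ} {cL : NNReal}
    (h : SupportLocallyFromZero A Abar rbar β ν cν cβ lf cL r₀ F κ) :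
    ∀ a ∈ F.fst.support, ∀ z₁ z₂ : ℝ, 0 ≤ z₁ → z₁ < z₂ →
      cdf (κ a) z₂ - cdf (κ a) z₁ ≤ cν * (z₂ - z₁) ^ ν := by
  intro a ha z₁ z₂ _ h12
  obtain ⟨l, u, -, -, hlaw, -⟩ := h.reward_law
  obtain ⟨-, hsupp, hH⟩ := hlaw a ha
  exact hH.sub_le h.ν_pos h.cν_pos
    (cdf_eq_one_of_support_subset (hsupp.trans_subset Set.Icc_subset_Iic_self))
    (.inr (cdf_eq_zero_of_support_subset (hsupp.trans_subset Set.Icc_subset_Ici_self)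
      (h.no_point_mass a ha _))) h12

theorem SupportLocallyFromZero.exists_integral_score_sq_le {S : Set (Vec m)}
    {β ν cν cβ lf r₀ : ℝ} (cL : NNReal) (hA : 0 < A) (hAA : A ≤ Abar) (hR : 0 ≤ R) (hβ : 0 ≤ β)
    (hcν : 0 < cν) (hcβ : 0 < cβ) (hlf : 0 < lf) (hr₀ : 0 < r₀)
    (hconv : Convex ℝ S) (hcomp : IsCompact S) (hint : (interior S).Nonempty) :
    ∃ K : ℝ, 0 < K ∧ ∀ (F : Measure (Vec m × ℝ)) [IsProbabilityMeasure F]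
      (κ : Kernel (Vec m) ℝ) [IsMarkovKernel κ] [F.IsCondKernel κ], F.fst.support = S →
      SupportLocallyFromZero A Abar rbar β ν cν cβ lf cL r₀ F κ →
      ∀ x y : Vec m, InBox 0 R x → InBox 0 R y →
        ∫ p, score x (y - x) p ^ 2 ∂F ≤ K * dualGap F κ y x ^ (2 / (2 + β)) := by
  have hAbar : 0 < Abar := hA.trans_le hAA
  set M : ℝ := m * Abar * R with hM
  have hM0 : 0 ≤ M := by positivity
  set q : ℝ := (1 / cν) ^ (1 / ν) / 4 with hqdef
  have hq : 0 < q := by positivity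
  set B : ℝ := √(m * R ^ 2) with hBdef
  have hB0 : 0 ≤ B := Real.sqrt_nonneg _
  set ρ : ℝ := min r₀ (q / (B + cL + 1)) with hρdef
  have hρ0 : 0 < ρ := by positivity
  have hρq : ρ * (B + cL) ≤ q := by
    have h1 : ρ ≤ q / (B + cL + 1) := min_le_right _ _
    rw [le_div_iff₀ (by positivity)] at h1
    linarith
  obtain ⟨c, hc, hgeo⟩ := exists_large_linear_form hconv hcomp.isBounded hint hρ0
  set c₀ : ℝ := cβ * (q / (q + M)) ^ (1 + β) with hc₀def
  have hc₀ : 0 < c₀ := by positivity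
  set c₁ : ℝ := c₀ * c ^ (2 + β) * (lf * c) with hc₁def
  have hc₁ : 0 < c₁ := by positivity
  set θ : ℝ := 2 / (2 + β) with hθ
  set K₁ : ℝ := (cβ ^ θ)⁻¹ + M * M ^ (1 - θ) with hK₁
  have hK₁0 : 0 < K₁ := by positivity
  set K₂ : ℝ := m * Abar ^ 2 * (c₁ ^ θ)⁻¹ with hK₂
  have hK₂0 : 0 ≤ K₂ := by positivity
  refine ⟨K₁ + K₂, by positivity, ?_⟩
  intro F _ κ _ _ hS h x y hx hy
  have hF := h.bounded
  obtain ⟨p, -, hp, hpl⟩ := h.density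
  obtain ⟨l, u, hl, hu, hlaw, a₀, ha₀, hzero⟩ := h.reward_law
  have hbox : ∀ a ∈ F.fst.support, InBox A Abar a := fun a => hF.inBox_of_mem
  have hcdf : ∀ a ∈ F.fst.support, cdf (κ a) (l a) = 0 ∧ cdf (κ a) (u a) = 1 := fun a ha =>
    ⟨cdf_eq_zero_of_support_subset ((hlaw a ha).2.1.trans_subset Set.Icc_subset_Ici_self)
      (h.no_point_mass a ha _),
    cdf_eq_one_of_support_subset ((hlaw a ha).2.1.trans_subset Set.Icc_subset_Iic_self)⟩
  have hlen : ∀ a ∈ F.fst.support, 4 * q ≤ u a - l a := fun a ha => by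
    rw [hqdef, mul_div_cancel₀ _ (by norm_num : (4 : ℝ) ≠ 0)]
    exact (hlaw a ha).2.2.le_sub h.ν_pos hcν (hlaw a ha).1 (hcdf a ha).1 (hcdf a ha).2
  have hgap0 : 0 ≤ dualGap F κ y x ^ θ := Real.rpow_nonneg (dualGap_nonneg _ _) _
  -- prices that reach the lower half of some reward interval force a quadratic gap
  have hgood : ∀ x y : Vec m, InBox 0 R x → InBox 0 R y →
      (∃ a ∈ F.fst.support, dot a x ≤ (l a + u a) / 2) →
      c₁ * ‖y - x‖ ^ (2 + β) ≤ dualGap F κ y x := by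
    intro x y hx hy hlow
    obtain ⟨a₂, ha₂, h₂⟩ := exists_interior_price (ρ := ρ) (q := q) (B := B)
      h.convex_support.isPreconnected hl hu
      hlen hq ha₀ hzero (min_le_left _ _) hρq (hx.norm_le le_rfl)
      (fun a ha => (hbox a ha).dot_nonneg hA hx) hlow
    obtain ⟨E, hE, hES, hvol, hlin⟩ := hgeo a₂ (hS ▸ ha₂) (y - x)
    refine hF.dualGap_ge hβ hlf.le hc.le hc₀.le hp hpl hx hy hE (hS ▸ hES) hvol hlin
      fun a ha => ?_
    obtain ⟨e1, e2, e3⟩ := h₂ a ha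
    have hMa := (hbox a ha.1).abs_dot_sub_le hA hx hy
    rw [dot_sub] at hMa
    exact (hlaw a ha.1).2.2.gap_ge hβ hq e1 e2 (e3 _ ((hbox a ha.1).dot_nonneg hA hy)) hMa
  by_cases hlow : (∃ a ∈ F.fst.support, dot a x ≤ (l a + u a) / 2) ∨
      ∃ a ∈ F.fst.support, dot a y ≤ (l a + u a) / 2
  · have h1 : c₁ * ‖y - x‖ ^ (2 + β) ≤ dualGap F κ y x := by
      rcases hlow with hlow | hlow
      · exact hgood x y hx hy hlow
      · rw [dualGap_comm, norm_sub_rev]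
        exact hgood y x hy hx hlow
    have h2 := sq_le_rpow_of_rpow_le hβ hc₁ (norm_nonneg (y - x)) h1
    calc ∫ p, score x (y - x) p ^ 2 ∂F ≤ m * Abar ^ 2 * ‖y - x‖ ^ 2 :=
          hF.integral_score_sq_le_norm hx hy
      _ ≤ m * Abar ^ 2 * ((c₁ ^ θ)⁻¹ * dualGap F κ y x ^ θ) := by gcongr
      _ = K₂ * dualGap F κ y x ^ θ := by rw [hK₂]; ring
      _ ≤ (K₁ + K₂) * dualGap F κ y x ^ θ := by gcongr; linarith
  · push Not at hlow
    refine (hF.integral_score_sq_le (κ := κ) (θ := θ) hx hy hK₁0.le (by positivity)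
      (by rw [hθ, div_le_one (by positivity)]; linarith) fun a ha => ?_).trans
      (by gcongr; linarith)
    have hMa := (hbox a ha).abs_dot_sub_le hA hx hy
    rw [dot_sub] at hMa
    have hlu := (hlaw a ha).1
    exact (hlaw a ha).2.2.variance_le hβ hcβ (hcdf a ha).2 (by linarith [hlow.1 a ha])
      (by linarith [hlow.2 a ha]) hMa

end LocallyFromZero

theorem SupportFromZero.exists_concentrationBounds (m : ℕ) (A Abar rbar ν cν β cβ : ℝ) :
    ∃ C₄ : ℝ, 0 < C₄ ∧ ∀ (F : Measure (Vec m × ℝ)) [IsProbabilityMeasure F]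
      (κ : Kernel (Vec m) ℝ) [IsMarkovKernel κ] [F.IsCondKernel κ],
      SupportFromZero A Abar rbar β ν cν cβ F κ →
      ConcentrationBounds 1 1 C₄ (rbar / A) β F κ := by
  by_cases hpar : 0 < A ∧ A ≤ Abar ∧ 0 < rbar ∧ 0 < ν ∧ 0 ≤ β ∧ 0 < cβ
  · obtain ⟨hA, hAA, hr, hν, hβ, hcβ⟩ := hpar
    have hAbar : 0 < Abar := hA.trans_le hAA
    obtain ⟨C₄, hC₄, h⟩ := ResourceAllocation.exists_concentrationBounds m (cν := cν) hA hAA hr hν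
      hβ (show 0 < (cβ ^ (2 / (2 + β)))⁻¹ +
        (m * Abar * (rbar / A)) * (m * Abar * (rbar / A)) ^ (1 - 2 / (2 + β)) by positivity)
    exact ⟨C₄, hC₄, fun F _ κ _ _ hF => h F κ hF.bounded hF.cdf_sub_le fun x y hx hy =>
      hF.integral_score_sq_le (by positivity) hx hy⟩
  · exact ⟨1, one_pos, fun F _ κ _ _ hF => absurd ⟨hF.bounded.lower_pos,
      hF.bounded.lower_le_upper, hF.bounded.reward_pos, hF.ν_pos, hF.β_nonneg, hF.cβ_pos⟩ hpar⟩

theorem SupportLocallyFromZero.exists_concentrationBounds (m : ℕ) (A Abar rbar ν cν β cβ : ℝ)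
    (S : Set (Vec m)) (lf : ℝ) (cL : NNReal) (r₀ : ℝ) :
    ∃ C₄ : ℝ, 0 < C₄ ∧ ∀ (F : Measure (Vec m × ℝ)) [IsProbabilityMeasure F]
      (κ : Kernel (Vec m) ℝ) [IsMarkovKernel κ] [F.IsCondKernel κ], F.fst.support = S →
      SupportLocallyFromZero A Abar rbar β ν cν cβ lf cL r₀ F κ →
      ConcentrationBounds 1 1 C₄ (rbar / A) β F κ := by
  by_cases hpar : (0 < A ∧ A ≤ Abar ∧ 0 < rbar ∧ 0 < ν ∧ 0 < cν ∧ 0 ≤ β ∧ 0 < cβ ∧ 0 < lf ∧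
      0 < r₀) ∧ Convex ℝ S ∧ IsCompact S ∧ (interior S).Nonempty
  · obtain ⟨⟨hA, hAA, hr, hν, hcν, hβ, hcβ, hlf, hr₀⟩, hconv, hcomp, hint⟩ := hpar
    obtain ⟨K, hK, hvar⟩ := exists_integral_score_sq_le (rbar := rbar) (ν := ν) cL hA hAA
      (R := rbar / A) (by positivity) hβ hcν hcβ hlf hr₀ hconv hcomp hint
    obtain ⟨C₄, hC₄, h⟩ := ResourceAllocation.exists_concentrationBounds m (cν := cν) hA hAA hr hν
      hβ hK
    exact ⟨C₄, hC₄, fun F _ κ _ _ hS hF => h F κ hF.bounded hF.cdf_sub_le (hvar F κ hS hF)⟩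
  · refine ⟨1, one_pos, fun F _ κ _ _ hS hF => absurd ⟨⟨hF.bounded.lower_pos,
      hF.bounded.lower_le_upper, hF.bounded.reward_pos, hF.ν_pos, hF.cν_pos, hF.β_nonneg,
      hF.cβ_pos, hF.lf_pos, hF.r₀_pos⟩, hS ▸ hF.convex_support, hS ▸ hF.compact_support, ?_⟩ hpar⟩
    obtain ⟨p, -, hp, -⟩ := hF.density
    exact hS ▸ interior_nonempty_of_density hp hF.convex_support

end ResourceAllocation

theorem lemma6 :
    ∃ C : ℝ, 0 < C ∧
      ∀ (m : ℕ) (A Abar rbar ν cν : ℝ),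
        ∃ C₁ : ℝ, 0 < C₁ ∧
          ∀ β cβ : ℝ,
            (∃ C₄ : ℝ, 0 < C₄ ∧
              ∀ (F : Measure (ResourceAllocation.Vec m × ℝ)) [IsProbabilityMeasure F]
                (κ : Kernel (ResourceAllocation.Vec m) ℝ) [IsMarkovKernel κ] [F.IsCondKernel κ],
                ResourceAllocation.SupportFromZero A Abar rbar β ν cν cβ F κ →
                ResourceAllocation.ConcentrationBounds C C₁ C₄ (rbar / A) β F κ) ∧
            (∀ (S : Set (ResourceAllocation.Vec m)) (lf : ℝ) (cL : NNReal) (r₀ : ℝ),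
              ∃ C₄ : ℝ, 0 < C₄ ∧
                ∀ (F : Measure (ResourceAllocation.Vec m × ℝ)) [IsProbabilityMeasure F]
                  (κ : Kernel (ResourceAllocation.Vec m) ℝ) [IsMarkovKernel κ] [F.IsCondKernel κ],
                  F.fst.support = S →
                  ResourceAllocation.SupportLocallyFromZero
                    A Abar rbar β ν cν cβ lf cL r₀ F κ →
                  ResourceAllocation.ConcentrationBounds C C₁ C₄ (rbar / A) β F κ) := by
  exact ⟨1, one_pos, fun m A Abar rbar ν cν => ⟨1, one_pos, fun β cβ =>
    ⟨ResourceAllocation.SupportFromZero.exists_concentrationBounds m A Abar rbar ν cν β cβ,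
      fun S lf cL r₀ => ResourceAllocation.SupportLocallyFromZero.exists_concentrationBounds
        m A Abar rbar ν cν β cβ S lf cL r₀⟩⟩⟩
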